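/- Let $\bar{\mathfrak g}$ be a complex Lie algebra with a nondegenerate symmetric bilinear form $(\cdot,\cdot)$ that is invariant: $([v,v_1],v_2)+(v_1,[v,v_2])=0$. Fix a point $P\in\mathbb P^1$ and a coordinate $u$ on $\mathbb P^1$ with a simple pole at $P$; $u$ identifies $\mathbb P^1\setminus P$ with $\mathbb C$. For $S\subset\mathbb P^1\setminus P$ let $\mathfrak g_-^S=\bar{\mathfrak g}\otimes\mathfrak m_P^S$ be the Lie algebra of $\bar{\mathfrak g}$-valued meromorphic functions on $\mathbb P^1$ that vanish at $P$ and are regular on $S$, and let $U\mathfrak g_-^S$ be its universal enveloping algebra; write $\mathfrak g_-=\mathfrak g_-^{\emptyset}$ and $\mathfrak g_-^{z_1,\dots}=\mathfrak g_-^{\{z_1,\dots\}}$. For $T\subset S$ the inclusion $\mathfrak g_-^S\subset\mathfrak g_-^T$ induces a map $U\mathfrak g_-^S\to U\mathfrak g_-^T$, which is suppressed in the notation. For $v\in\bar{\mathfrak g}$ and $z\ne P$, let $\epsilon^v(z)=\hat\epsilon^v(z)\,du_z$, where $\hat\epsilon^v(z)$ is left multiplication by $v/(u-u(z))$, and let $\iota^v(z)=\hat\iota^v(z)\,du_z$,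 where $\hat\iota^v(z):U\mathfrak g_-^z\to U\mathfrak g_-^z$ (linear in $v$) is the unique family of operators with $\hat\iota^v(z)\mathbf 1=0$ and, for $\alpha\in\mathfrak g_-^z$ acting by left multiplication, $$\hat\iota^v(z)\circ\alpha-\alpha\circ\hat\iota^v(z)=-\Big[v,\frac{\alpha-\alpha(z)}{u-u(z)}\Big]-\Big(v,\frac{d\alpha}{du}(z)\Big)+\hat\iota^{[v,\alpha(z)]}(z),$$ where the first term on the right is $-[\hat\epsilon^v(z),\alpha]+\hat\epsilon^{[v,\alpha(z)]}(z)$. For every $S\ni z$ the operator $\hat\iota^v(z)$ is defined on $U\mathfrak g_-^S$ in the same way. The current is $j^v(z)=\epsilon^v(z)+\iota^v(z)=\hat\jmath^v(z)\,du_z$; it maps $U\mathfrak g_-^S$ to $U\mathfrak g_-^{T}\otimes K_z$ for $z\in S$, $T\subset S\setminus\{z\}$, where $K_z$ is the fibre at $z$ of the canonical bundle. Let $v_1,v_2\in\bar{\mathfrak g}$. (1) If $z_1\neq z_2$ are points of $\mathbb P^1\setminus P$, then $j^{v_1}(z_1)$ and $j^{v_2}(z_2)$ can be composed in either order on $U\mathfrak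 g_-^{z_1,z_2}$, and $\hat\jmath^{v_1}(z_1)\hat\jmath^{v_2}(z_2)=\hat\jmath^{v_2}(z_2)\hat\jmath^{v_1}(z_1)$ as maps $U\mathfrak g_-^{z_1,z_2}\to U\mathfrak g_-$. (2) Let $z_1\in\mathbb P^1\setminus P$. Every vector of $U\mathfrak g_-^{z_1}$ comes from $U\mathfrak g_-^V$ for some Zariski-open neighbourhood $V\subset\mathbb P^1\setminus P$ of $z_1$. For every such $V$ and every vector of $U\mathfrak g_-^V$, the following holds when both sides are applied to that vector: as $z_2\to z_1$, $$\hat\jmath^{v_2}(z_2)\hat\jmath^{v_1}(z_1)-\frac{(v_1,v_2)}{(u(z_1)-u(z_2))^2}-\frac{1}{u(z_2)-u(z_1)}\hat\jmath^{[v_2,v_1]}(z_1)$$ $$\longrightarrow\ \hat\iota^{v_2}(z_1)\hat\iota^{v_1}(z_1)+\hat\epsilon^{v_2}(z_1)\hat\epsilon^{v_1}(z_1)+\hat\epsilon^{v_2}(z_1)\hat\iota^{v_1}(z_1)+\hat\epsilon^{v_1}(z_1)\hat\iota^{v_2}(z_1)+\frac{d\hat\iota^{[v_2,v_1]}}{du}(z_1),$$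 where the derivative is the limit of the difference quotients of $z\mapsto\hat\iota^{[v_2,v_1]}(z)$ (and exists). Limits are algebraic: the left side, as a family over $V\setminus\{z_1\}$, extends to a regular family of vectors of $U\mathfrak g_-$ over $V$, with the stated value at $z_1$. Here the regular families over $V$ form the algebra generated by the regular functions on $V$ and the families $t\mapsto x\otimes a(\cdot,t)$, where $x\in\bar{\mathfrak g}$ and $a(u,t)$ is a rational function of $(u,t)$, regular for $t\in V$ apart from poles along the diagonal $u=t$ and finitely many lines $u=\mathrm{const}$, and vanishing along $u=\infty$. -/

import Mathlib

open Polynomial TensorProduct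

noncomputable section

namespace CurrentAlgebra

/-! ### Rational functions on the projective line

A coordinate `u` with a simple pole at the base point `P` is fixed; it identifies the projective
line with `ℂ ∪ {∞}`, the point `P` with `∞`, its complement with `ℂ`, and the field of meromorphic
functions with `RatFunc ℂ` (the variable being `u`).  Over the complement of `P` the canonical
bundle is trivialised by `du`, and an operator-valued one-form `j(z) = ĵ(z) du_z` is recorded
by its coefficient `ĵ(z)`. -/

/-- `f` vanishes at `∞` and has no pole in `S`. -/
def VanishReg (S : Set ℂ) (f : RatFunc ℂ) : Prop :=
  f.num.degree < f.denom.degree ∧ ∀ z ∈ S, f.denom.eval z ≠ 0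

theorem vanishReg_of_eq {S : Set ℂ} {f : RatFunc ℂ} (p q : ℂ[X]) (hd : p.degree < q.degree)
    (hS : ∀ z ∈ S, q.eval z ≠ 0) (hf : f = algebraMap ℂ[X] (RatFunc ℂ) p / algebraMap _ _ q) :
    VanishReg S f := by
  have hq : q ≠ 0 := by rintro rfl; simp at hd
  have hcross : f.num * q = p * f.denom := (RatFunc.num_mul_eq_mul_denom_iff hq).2 hf
  constructor
  · have h1 := congrArg Polynomial.degree hcross
    rw [degree_mul, degree_mul] at h1
    by_contra! hcon
    by_cases hn : f.num = 0
    · simp [hn, degree_eq_bot, RatFunc.denom_ne_zero] at hcon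
    · have hp : p ≠ 0 := by
        rintro rfl
        have : f.num * q = 0 := by simpa using hcross
        exact (mul_ne_zero hn hq) this
      rw [degree_eq_natDegree hn, degree_eq_natDegree hq, degree_eq_natDegree hp,
        degree_eq_natDegree (RatFunc.denom_ne_zero f)] at h1
      rw [degree_eq_natDegree hn, degree_eq_natDegree (RatFunc.denom_ne_zero f)] at hcon
      rw [degree_eq_natDegree hp, degree_eq_natDegree hq] at hd
      norm_cast at h1 hcon hd
      omega
  · intro z hz h0
    obtain ⟨r, hr⟩ : f.denom ∣ q := (RatFunc.denom_dvd hq).2 ⟨p, hf⟩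
    apply hS z hz
    rw [hr, eval_mul, h0, zero_mul]

theorem VanishReg.exists_eq {S : Set ℂ} {f : RatFunc ℂ} (h : VanishReg S f) :
    ∃ p q : ℂ[X], p.degree < q.degree ∧ (∀ z ∈ S, q.eval z ≠ 0) ∧
      f = algebraMap ℂ[X] (RatFunc ℂ) p / algebraMap _ _ q :=
  ⟨f.num, f.denom, h.1, h.2, (RatFunc.num_div_denom f).symm⟩

theorem algebraMap_ne_zero {q : ℂ[X]} (hq : q ≠ 0) : algebraMap ℂ[X] (RatFunc ℂ) q ≠ 0 := by
  simpa using hq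

/-- The algebra (without unit) of rational functions that vanish at `∞` and are regular at every
point of `S`.  For `S = ∅` this is the maximal ideal of the local ring at `P`. -/
def vanishing (S : Set ℂ) : NonUnitalSubalgebra ℂ (RatFunc ℂ) where
  carrier := {f | VanishReg S f}
  zero_mem' := by
    refine vanishReg_of_eq 0 1 ?_ ?_ ?_ <;> simp
  add_mem' := by
    rintro f g hf hg
    obtain ⟨p, q, hd, hS, rfl⟩ := VanishReg.exists_eq hf
    obtain ⟨p', q', hd', hS', rfl⟩ := VanishReg.exists_eq hg
    have hq : q ≠ 0 := by rintro rfl; simp at hd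
    have hq' : q' ≠ 0 := by rintro rfl; simp at hd'
    refine vanishReg_of_eq (p * q' + q * p') (q * q') ?_ ?_ ?_
    · refine (degree_add_le _ _).trans_lt (max_lt ?_ ?_)
      · rw [degree_mul, degree_mul]
        exact WithBot.add_lt_add_right (by simpa using hq') hd
      · rw [degree_mul, degree_mul]
        exact WithBot.add_lt_add_left (by simpa using hq) hd'
    · intro z hz
      rw [eval_mul]
      exact mul_ne_zero (hS z hz) (hS' z hz)
    · have := algebraMap_ne_zero hq
      have := algebraMap_ne_zero hq'
      simp only [map_add, map_mul]
      field_simp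
  mul_mem' := by
    rintro f g hf hg
    obtain ⟨p, q, hd, hS, rfl⟩ := VanishReg.exists_eq hf
    obtain ⟨p', q', hd', hS', rfl⟩ := VanishReg.exists_eq hg
    have hq : q ≠ 0 := by rintro rfl; simp at hd
    refine vanishReg_of_eq (p * p') (q * q') ?_ ?_ ?_
    · by_cases hp : p = 0
      · have hq' : q' ≠ 0 := by rintro rfl; simp at hd'
        simp [hp, bot_lt_iff_ne_bot, degree_eq_bot, hq, hq']
      · rw [degree_mul, degree_mul]
        exact (WithBot.add_lt_add_left (by simpa using hp) hd').trans_le (by gcongr)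
    · intro z hz
      rw [eval_mul]
      exact mul_ne_zero (hS z hz) (hS' z hz)
    · simp only [map_mul]
      rw [div_mul_div_comm]
  smul_mem' := by
    rintro c f hf
    obtain ⟨p, q, hd, hS, rfl⟩ := VanishReg.exists_eq hf
    refine vanishReg_of_eq (c • p) q ((degree_smul_le _ _).trans_lt hd) hS ?_
    rw [Polynomial.smul_eq_C_mul, map_mul, RatFunc.algebraMap_C, RatFunc.smul_eq_C_mul,
      mul_div_assoc]

theorem vanishing_mono {S T : Set ℂ} (h : T ⊆ S) : vanishing S ≤ vanishing T :=
  fun _ hf => ⟨hf.1, fun z hz => hf.2 z (h hz)⟩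

/-- The value `f(z)`. -/
def val (z : ℂ) (f : RatFunc ℂ) : ℂ := f.eval (RingHom.id ℂ) z

/-- The derivative `f'(z)`, so that `df(z) = f'(z) du_z`. -/
def der (z : ℂ) (f : RatFunc ℂ) : ℂ := deriv (fun w => val w f) z

theorem VanishReg.ev_ne {S : Set ℂ} {f : RatFunc ℂ} (h : VanishReg S f) {z : ℂ} (hz : z ∈ S) :
    Polynomial.eval₂ (RingHom.id ℂ) z f.denom ≠ 0 := h.2 z hz

theorem val_add {S : Set ℂ} {f g : RatFunc ℂ} (hf : VanishReg S f) (hg : VanishReg S g)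
    {z : ℂ} (hz : z ∈ S) : val z (f + g) = val z f + val z g :=
  RatFunc.eval_add _ z (hf.ev_ne hz) (hg.ev_ne hz)

theorem val_mul {S : Set ℂ} {f g : RatFunc ℂ} (hf : VanishReg S f) (hg : VanishReg S g)
    {z : ℂ} (hz : z ∈ S) : val z (f * g) = val z f * val z g :=
  RatFunc.eval_mul _ z (hf.ev_ne hz) (hg.ev_ne hz)

theorem val_smul {S : Set ℂ} {f : RatFunc ℂ} (c : ℂ) (hf : VanishReg S f)
    {z : ℂ} (hz : z ∈ S) : val z (c • f) = c * val z f := by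
  rw [RatFunc.smul_eq_C_mul]
  unfold val
  rw [RatFunc.eval_mul _ z (by simp) (hf.ev_ne hz), RatFunc.eval_C, RingHom.id_apply]

theorem VanishReg.eventually {S : Set ℂ} {f : RatFunc ℂ} (hf : VanishReg S f) {z : ℂ} (hz : z ∈ S) :
    ∀ᶠ w in nhds z, VanishReg {w} f := by
  have : ∀ᶠ w in nhds z, f.denom.eval w ≠ 0 :=
    f.denom.continuous.continuousAt.eventually_ne (hf.2 z hz)
  filter_upwards [this] with w hw
  exact ⟨hf.1, by simpa using hw⟩

theorem VanishReg.differentiableAt {S : Set ℂ} {f : RatFunc ℂ} (hf : VanishReg S f) {z : ℂ}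
    (hz : z ∈ S) : DifferentiableAt ℂ (fun w => val w f) z := by
  change DifferentiableAt ℂ (fun w => f.num.eval w / f.denom.eval w) z
  exact f.num.differentiable.differentiableAt.div f.denom.differentiable.differentiableAt
    (hf.2 z hz)

theorem der_add {S : Set ℂ} {f g : RatFunc ℂ} (hf : VanishReg S f) (hg : VanishReg S g)
    {z : ℂ} (hz : z ∈ S) : der z (f + g) = der z f + der z g := by
  unfold der
  rw [← deriv_fun_add (hf.differentiableAt hz) (hg.differentiableAt hz)]
  refine Filter.EventuallyEq.deriv_eq ?_
  filter_upwards [hf.eventually hz, hg.eventually hz] with w h1 h2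
  exact val_add h1 h2 rfl

theorem der_mul {S : Set ℂ} {f g : RatFunc ℂ} (hf : VanishReg S f) (hg : VanishReg S g)
    {z : ℂ} (hz : z ∈ S) : der z (f * g) = der z f * val z g + val z f * der z g := by
  unfold der
  rw [← deriv_fun_mul (hf.differentiableAt hz) (hg.differentiableAt hz)]
  refine Filter.EventuallyEq.deriv_eq ?_
  filter_upwards [hf.eventually hz, hg.eventually hz] with w h1 h2
  exact val_mul h1 h2 rfl

theorem der_smul {S : Set ℂ} {f : RatFunc ℂ} (c : ℂ) (hf : VanishReg S f)
    {z : ℂ} (hz : z ∈ S) : der z (c • f) = c * der z f := by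
  unfold der
  rw [← deriv_const_mul c (hf.differentiableAt hz)]
  refine Filter.EventuallyEq.deriv_eq ?_
  filter_upwards [hf.eventually hz] with w h1
  exact val_smul c h1 rfl

theorem X_sub_C_ne_zero' (z : ℂ) : (RatFunc.X - RatFunc.C z : RatFunc ℂ) ≠ 0 := by
  have := algebraMap_ne_zero (Polynomial.X_sub_C_ne_zero z)
  simpa using this

/-- The function `1 / (u - z)`, as an element of `𝔪_P`, regular away from `z`. -/
def pole (T : Set ℂ) (z : ℂ) (hz : z ∉ T) : vanishing T :=
  ⟨(RatFunc.X - RatFunc.C z)⁻¹, by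
    refine vanishReg_of_eq 1 (X - C z) ?_ ?_ ?_
    · simp
    · intro w hw
      have : w ≠ z := fun h => hz (h ▸ hw)
      simpa [sub_eq_zero] using this
    · simp⟩

theorem divDiff_mem {S : Set ℂ} {z : ℂ} (hz : z ∈ S) {f : RatFunc ℂ} (hf : VanishReg S f) :
    VanishReg S ((f - RatFunc.C (val z f)) / (RatFunc.X - RatFunc.C z)) := by
  have hroot : (X - C z) ∣ f.num - C (val z f) * f.denom := by
    rw [dvd_iff_isRoot]
    have h : f.denom.eval z ≠ 0 := hf.2 z hz
    change Polynomial.eval z _ = 0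
    have hv : val z f = f.num.eval z / f.denom.eval z := rfl
    rw [eval_sub, eval_mul, eval_C, hv, div_mul_cancel₀ _ h, sub_self]
  obtain ⟨r, hr⟩ := hroot
  refine vanishReg_of_eq r f.denom ?_ hf.2 ?_
  · have h1 : (f.num - C (val z f) * f.denom).degree ≤ f.denom.degree := by
      refine (degree_sub_le _ _).trans (max_le hf.1.le ?_)
      rw [← Polynomial.smul_eq_C_mul]
      exact degree_smul_le _ _
    by_cases hr0 : r = 0
    · simp [hr0, bot_lt_iff_ne_bot, degree_eq_bot, RatFunc.denom_ne_zero]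
    rw [hr, degree_mul, degree_X_sub_C, degree_eq_natDegree hr0,
      degree_eq_natDegree (RatFunc.denom_ne_zero f)] at h1
    rw [degree_eq_natDegree hr0, degree_eq_natDegree (RatFunc.denom_ne_zero f)]
    norm_cast at h1 ⊢
    omega
  · have hX := X_sub_C_ne_zero' z
    have hd := algebraMap_ne_zero (RatFunc.denom_ne_zero f)
    have h2 := congrArg (algebraMap ℂ[X] (RatFunc ℂ)) hr
    simp only [map_sub, map_mul, RatFunc.algebraMap_C, RatFunc.algebraMap_X] at h2
    rw [div_eq_div_iff hX hd]
    have h3 : f * algebraMap ℂ[X] (RatFunc ℂ) f.denom = algebraMap _ _ f.num := by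
      conv_lhs => rw [← RatFunc.num_div_denom f]
      rw [RatFunc.num_div_denom]
      nth_rewrite 1 [← RatFunc.num_div_denom f]
      exact div_mul_cancel₀ _ hd
    rw [sub_mul, h3, h2, mul_comm]

theorem divDiff_mul {S : Set ℂ} {f g : RatFunc ℂ} (hf : VanishReg S f) (hg : VanishReg S g)
    {z : ℂ} (hz : z ∈ S) :
    (f * g - RatFunc.C (val z (f * g))) / (RatFunc.X - RatFunc.C z)
      = f * ((g - RatFunc.C (val z g)) / (RatFunc.X - RatFunc.C z))
        + val z g • ((f - RatFunc.C (val z f)) / (RatFunc.X - RatFunc.C z)) := by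
  have hX := X_sub_C_ne_zero' z
  rw [val_mul hf hg hz, map_mul, RatFunc.smul_eq_C_mul]
  field_simp
  ring

section FunctionMaps

variable {S : Set ℂ} {z : ℂ} (hz : z ∈ S)

/-- Evaluation at a point of regularity. -/
def valHom : vanishing S →ₗ[ℂ] ℂ where
  toFun f := val z (f : RatFunc ℂ)
  map_add' f g := val_add f.2 g.2 hz
  map_smul' c f := val_smul c f.2 hz

/-- Derivative at a point of regularity. -/
def derHom : vanishing S →ₗ[ℂ] ℂ where
  toFun f := der z (f : RatFunc ℂ)
  map_add' f g := der_add f.2 g.2 hz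
  map_smul' c f := der_smul c f.2 hz

/-- The map `f ↦ (f - f(z)) / (u - z)`. -/
def divDiff : vanishing S →ₗ[ℂ] vanishing S where
  toFun f := ⟨((f : RatFunc ℂ) - RatFunc.C (val z (f : RatFunc ℂ))) / (RatFunc.X - RatFunc.C z),
    divDiff_mem hz f.2⟩
  map_add' f g := by
    apply Subtype.ext
    change ((f : RatFunc ℂ) + g - RatFunc.C (val z ((f : RatFunc ℂ) + g))) / _ = _ / _ + _ / _
    rw [val_add f.2 g.2 hz, map_add]
    ring
  map_smul' c f := by
    apply Subtype.ext
    change (c • (f : RatFunc ℂ) - RatFunc.C (val z (c • (f : RatFunc ℂ)))) / _ = c • (_ / _)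
    rw [val_smul c f.2 hz, map_mul, RatFunc.smul_eq_C_mul, RatFunc.smul_eq_C_mul]
    ring

theorem valHom_mul (f g : vanishing S) : valHom hz (f * g) = valHom hz f * valHom hz g :=
  val_mul f.2 g.2 hz

theorem derHom_mul (f g : vanishing S) :
    derHom hz (f * g) = derHom hz f * valHom hz g + valHom hz f * derHom hz g :=
  der_mul f.2 g.2 hz

theorem divDiff_prod (f g : vanishing S) :
    divDiff hz (f * g) = f * divDiff hz g + valHom hz g • divDiff hz f :=
  Subtype.ext (divDiff_mul f.2 g.2 hz)

theorem divDiff_prod' (f g : vanishing S) :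
    divDiff hz (f * g) = valHom hz f • divDiff hz g + divDiff hz f * g := by
  rw [mul_comm f g, divDiff_prod, add_comm, mul_comm g]

end FunctionMaps

/-! ### The Lie algebra of `𝔤`-valued meromorphic functions vanishing at the base point -/

section LieAlg

attribute [local instance 100] LieRing.ofAssociativeRing

variable (𝔤 : Type*) [LieRing 𝔤] [LieAlgebra ℂ 𝔤]

/-- `𝔤 ⊗ 𝔪` where `𝔪` consists of the rational functions vanishing at `P` and regular on `S`:
the `𝔤`-valued meromorphic functions vanishing at `P` and regular on `S`.  The Lie algebra
`𝔤₋` itself is the case `S = ∅`. -/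
def gMinus (S : Set ℂ) : Type _ := 𝔤 ⊗[ℂ] (vanishing S)

instance (S : Set ℂ) : AddCommGroup (gMinus 𝔤 S) :=
  inferInstanceAs (AddCommGroup (𝔤 ⊗[ℂ] (vanishing S)))

instance (S : Set ℂ) : Module ℂ (gMinus 𝔤 S) :=
  inferInstanceAs (Module ℂ (𝔤 ⊗[ℂ] (vanishing S)))

variable {𝔤}

/-- The function `u ↦ f(u) x`. -/
def tens {S : Set ℂ} (x : 𝔤) (f : vanishing S) : gMinus 𝔤 S := x ⊗ₜ[ℂ] f

theorem gMinus_induction {S : Set ℂ} {p : gMinus 𝔤 S → Prop} (α : gMinus 𝔤 S) (h0 : p 0)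
    (h1 : ∀ x f, p (tens x f)) (h2 : ∀ α β, p α → p β → p (α + β)) : p α :=
  TensorProduct.induction_on α h0 h1 h2

theorem pure_add {S : Set ℂ} (x : 𝔤) (f g : vanishing S) :
    tens x (f + g) = tens x f + tens x g := TensorProduct.tmul_add _ _ _

theorem add_pure {S : Set ℂ} (x y : 𝔤) (f : vanishing S) :
    tens (x + y) f = tens x f + tens y f := TensorProduct.add_tmul _ _ _

theorem neg_pure {S : Set ℂ} (x : 𝔤) (f : vanishing S) :
    tens (-x) f = - tens x f := TensorProduct.neg_tmul _ _

theorem pure_smul {S : Set ℂ} (c : ℂ) (x : 𝔤) (f : vanishing S) :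
    tens x (c • f) = c • tens x f := TensorProduct.tmul_smul _ _ _

theorem smul_pure {S : Set ℂ} (c : ℂ) (x : 𝔤) (f : vanishing S) :
    tens (c • x) f = c • tens x f := rfl

/-- The pointwise bracket. -/
def bracketMap (S : Set ℂ) : gMinus 𝔤 S →ₗ[ℂ] gMinus 𝔤 S →ₗ[ℂ] gMinus 𝔤 S :=
  TensorProduct.map₂ (LieModule.toEnd ℂ 𝔤 𝔤 : 𝔤 →ₗ[ℂ] 𝔤 →ₗ[ℂ] 𝔤)
    (LinearMap.mul ℂ (vanishing S))

theorem bracketMap_pure {S : Set ℂ} (x y : 𝔤) (f g : vanishing S) :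
    bracketMap S (tens x f) (tens y g) = tens ⁅x, y⁆ (f * g) := rfl

instance (S : Set ℂ) : Bracket (gMinus 𝔤 S) (gMinus 𝔤 S) where
  bracket α β := bracketMap S α β

theorem lie_def {S : Set ℂ} (α β : gMinus 𝔤 S) : ⁅α, β⁆ = bracketMap S α β := rfl

theorem lie_pure {S : Set ℂ} (x y : 𝔤) (f g : vanishing S) :
    ⁅tens x f, tens y g⁆ = tens ⁅x, y⁆ (f * g) := rfl

theorem bracketMap_skew {S : Set ℂ} (α β : gMinus 𝔤 S) :
    bracketMap S α β + bracketMap S β α = 0 := by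
  induction α using gMinus_induction with
  | h0 => simp
  | h1 x f =>
    induction β using gMinus_induction with
    | h0 => simp
    | h1 y g =>
      rw [bracketMap_pure, bracketMap_pure, mul_comm g f, ← lie_skew x y, neg_pure,
        neg_add_cancel]
    | h2 β γ h1 h2 =>
      rw [map_add, map_add, LinearMap.add_apply, add_add_add_comm, h1, h2, add_zero]
  | h2 β γ h1 h2 =>
    rw [map_add, map_add, LinearMap.add_apply, add_add_add_comm, h1, h2, add_zero]

instance (S : Set ℂ) : LieRing (gMinus 𝔤 S) where
  add_lie α β γ := by simp only [lie_def, map_add, LinearMap.add_apply]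
  lie_add α β γ := by simp only [lie_def, map_add]
  lie_self α := by
    have h := bracketMap_skew α α
    rw [← two_smul ℂ] at h
    exact (smul_eq_zero.1 h).resolve_left two_ne_zero
  leibniz_lie α β γ := by
    simp only [lie_def]
    induction α using gMinus_induction with
    | h0 => simp
    | h1 x f =>
      induction β using gMinus_induction with
      | h0 => simp
      | h1 y g =>
        induction γ using gMinus_induction with
        | h0 => simp
        | h1 w h =>
          simp only [bracketMap_pure]
          rw [mul_left_comm g f h, mul_assoc, ← add_pure, ← leibniz_lie]
        | h2 β γ h1 h2 => simp only [map_add, h1, h2]; abel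
      | h2 β γ h1 h2 => simp only [map_add, LinearMap.add_apply, h1, h2]; abel
    | h2 β γ h1 h2 => simp only [map_add, LinearMap.add_apply, h1, h2]; abel

instance (S : Set ℂ) : LieAlgebra ℂ (gMinus 𝔤 S) where
  lie_smul c α β := by simp only [lie_def, map_smul]

/-- The linear map underlying `incl`. -/
def inclLin {S T : Set ℂ} (h : T ⊆ S) : gMinus 𝔤 S →ₗ[ℂ] gMinus 𝔤 T :=
  LinearMap.lTensor 𝔤
    (NonUnitalSubalgebra.inclusion (vanishing_mono h) : vanishing S →ₗ[ℂ] vanishing T)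

/-- Functions regular on `S` are regular on every subset `T` of `S`. -/
def incl {S T : Set ℂ} (h : T ⊆ S) : gMinus 𝔤 S →ₗ⁅ℂ⁆ gMinus 𝔤 T where
  __ := inclLin h
  map_lie' {α β} := by
    change inclLin h (bracketMap S α β) = bracketMap T (inclLin h α) (inclLin h β)
    induction α using gMinus_induction with
    | h0 => simp
    | h1 x f =>
      induction β using gMinus_induction with
      | h0 => simp
      | h1 y g => rfl
      | h2 β γ h1 h2 => simp only [map_add, h1, h2]
    | h2 β γ h1 h2 => simp only [map_add, LinearMap.add_apply, h1, h2]

theorem incl_pure {S T : Set ℂ} (h : T ⊆ S) (x : 𝔤) (f : vanishing S) :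
    incl h (tens x f) = tens x ⟨f, vanishing_mono h f.2⟩ := rfl

section AtPoint

variable {S : Set ℂ} {z : ℂ} (hz : z ∈ S)

/-- The value `α(z) ∈ 𝔤`. -/
def valueAt : gMinus 𝔤 S →ₗ[ℂ] 𝔤 :=
  (TensorProduct.rid ℂ 𝔤).toLinearMap ∘ₗ LinearMap.lTensor 𝔤 (valHom hz)

/-- The derivative `α'(z) ∈ 𝔤`, so that `dα(z) = α'(z) du_z`. -/
def derivAt : gMinus 𝔤 S →ₗ[ℂ] 𝔤 :=
  (TensorProduct.rid ℂ 𝔤).toLinearMap ∘ₗ LinearMap.lTensor 𝔤 (derHom hz)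

/-- The map `α ↦ [v, (α - α(z)) / (u - z)]`. -/
def divBracket : 𝔤 →ₗ[ℂ] gMinus 𝔤 S →ₗ[ℂ] gMinus 𝔤 S :=
  (LinearMap.flip (TensorProduct.mapBilinear (RingHom.id ℂ) 𝔤 (vanishing S) 𝔤 (vanishing S))
    (divDiff hz)) ∘ₗ (LieModule.toEnd ℂ 𝔤 𝔤 : 𝔤 →ₗ[ℂ] 𝔤 →ₗ[ℂ] 𝔤)

theorem valueAt_pure (x : 𝔤) (f : vanishing S) :
    valueAt hz (tens x f) = val z (f : RatFunc ℂ) • x := rfl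

theorem derivAt_pure (x : 𝔤) (f : vanishing S) :
    derivAt hz (tens x f) = der z (f : RatFunc ℂ) • x := rfl

theorem divBracket_pure (v x : 𝔤) (f : vanishing S) :
    divBracket hz v (tens x f) = tens ⁅v, x⁆ (divDiff hz f) := rfl

theorem valueAt_lie (α β : gMinus 𝔤 S) :
    valueAt hz ⁅α, β⁆ = ⁅valueAt hz α, valueAt hz β⁆ := by
  induction α using gMinus_induction with
  | h0 => simp
  | h1 x f =>
    induction β using gMinus_induction with
    | h0 => simp
    | h1 y g =>
      rw [lie_pure]
      simp only [valueAt_pure, smul_lie, lie_smul, smul_smul]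
      congr 1
      exact (valHom_mul hz f g).trans (mul_comm _ _)
    | h2 β γ h1 h2 => simp only [lie_add, map_add, h1, h2]
  | h2 β γ h1 h2 => simp only [add_lie, map_add, h1, h2]

theorem derivAt_lie (α β : gMinus 𝔤 S) :
    derivAt hz ⁅α, β⁆ = ⁅derivAt hz α, valueAt hz β⁆ + ⁅valueAt hz α, derivAt hz β⁆ := by
  induction α using gMinus_induction with
  | h0 => simp
  | h1 x f =>
    induction β using gMinus_induction with
    | h0 => simp
    | h1 y g =>
      rw [lie_pure]
      simp only [valueAt_pure, derivAt_pure, smul_lie, lie_smul, smul_smul, ← add_smul]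
      congr 1
      refine (derHom_mul hz f g).trans ?_
      change der z (f : RatFunc ℂ) * val z (g : RatFunc ℂ) +
        val z (f : RatFunc ℂ) * der z (g : RatFunc ℂ) = _
      ring
    | h2 β γ h1 h2 => simp only [lie_add, map_add, h1, h2]; abel
  | h2 β γ h1 h2 => simp only [add_lie, map_add, h1, h2]; abel

theorem divBracket_lie (v : 𝔤) (α β : gMinus 𝔤 S) :
    divBracket hz v ⁅α, β⁆ = ⁅divBracket hz v α, β⁆ + ⁅α, divBracket hz v β⁆
      + divBracket hz ⁅v, valueAt hz α⁆ β - divBracket hz ⁅v, valueAt hz β⁆ α := by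
  induction α using gMinus_induction with
  | h0 => simp
  | h1 x f =>
    induction β using gMinus_induction with
    | h0 => simp
    | h1 y g =>
      simp only [lie_pure, valueAt_pure, divBracket_pure, lie_smul, map_smul,
        LinearMap.smul_apply]
      rw [leibniz_lie v x y, add_pure]
      conv_lhs =>
        congr
        · rw [divDiff_prod', pure_add, pure_smul]
        · rw [divDiff_prod, pure_add, pure_smul]
      rw [← lie_skew ⁅v, y⁆ x, neg_pure, smul_neg, sub_neg_eq_add]
      change val z (f : RatFunc ℂ) • _ + _ + (_ + val z (g : RatFunc ℂ) • _) = _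
      abel
    | h2 β γ h1 h2 =>
      simp only [lie_add, map_add, h1, h2, LinearMap.add_apply]; abel
  | h2 β γ h1 h2 => simp only [add_lie, lie_add, map_add, h1, h2, LinearMap.add_apply]; abel

end AtPoint

/-! ### The fields -/

variable (𝔤) in
/-- The universal enveloping algebra of `gMinus 𝔤 S`. -/
abbrev Env (S : Set ℂ) : Type _ := UniversalEnvelopingAlgebra ℂ (gMinus 𝔤 S)

/-- The canonical map of `gMinus 𝔤 S` to its enveloping algebra. -/
def gen {S : Set ℂ} : gMinus 𝔤 S →ₗ⁅ℂ⁆ Env 𝔤 S := UniversalEnvelopingAlgebra.ι ℂ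

/-- The algebra map of enveloping algebras induced by `incl`. -/
def restr {S T : Set ℂ} (h : T ⊆ S) : Env 𝔤 S →ₐ[ℂ] Env 𝔤 T :=
  UniversalEnvelopingAlgebra.lift ℂ (gen.comp (incl h))

/-- The function `v / (u - z)`. -/
def polePart (T : Set ℂ) {z : ℂ} (hz : z ∉ T) : 𝔤 →ₗ[ℂ] gMinus 𝔤 T where
  toFun v := tens v (pole T z hz)
  map_add' _ _ := add_pure _ _ _
  map_smul' _ _ := smul_pure _ _ _

/-- The field `ε̂^v(z)`: left multiplication by `v / (u - z)`. -/
def epsilon (T : Set ℂ) {z : ℂ} (hz : z ∉ T) (v : 𝔤) : Env 𝔤 T →ₗ[ℂ] Env 𝔤 T :=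
  LinearMap.mulLeft ℂ (gen (polePart T hz v))

/-- The combination `[ε^v(z), α] - ε^{[v, α(z)]}(z)`, in which each term has a pole at `z`,
is `divBracket`, which is regular at `z`. -/
theorem polePart_lie {S T : Set ℂ} (h : T ⊆ S) {z : ℂ} (hz : z ∈ S) (hzT : z ∉ T) (v : 𝔤)
    (α : gMinus 𝔤 S) :
    ⁅polePart T hzT v, incl h α⁆ - polePart T hzT ⁅v, valueAt hz α⁆
      = incl h (divBracket hz v α) := by
  induction α using gMinus_induction with
  | h0 => simp
  | h1 x f =>
    rw [divBracket_pure, incl_pure, incl_pure, valueAt_pure, lie_smul, map_smul]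
    change tens ⁅v, x⁆ _ - _ • tens ⁅v, x⁆ _ = _
    rw [← pure_smul, sub_eq_add_neg, ← neg_one_smul ℂ (tens _ _), ← pure_smul, ← pure_add]
    congr 1
    apply Subtype.ext
    change (RatFunc.X - RatFunc.C z)⁻¹ * (f : RatFunc ℂ) + (-1 : ℂ) • (val z (f : RatFunc ℂ) •
      (RatFunc.X - RatFunc.C z)⁻¹) =
      ((f : RatFunc ℂ) - RatFunc.C (val z (f : RatFunc ℂ))) / (RatFunc.X - RatFunc.C z)
    rw [neg_one_smul, RatFunc.smul_eq_C_mul]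
    ring
  | h2 β γ h1 h2 =>
    simp only [map_add, lie_add, ← h1, ← h2]; abel

/-- The defining conditions of the field `ι̂(z)`:  `ι̂^v(z) 1 = 0`, and for left multiplication by
`α` regular at `z`,
`ι̂^v(z) ∘ α - α ∘ ι̂^v(z) = -([ε̂^v(z), α] - ε̂^{[v, α(z)]}(z)) - (v, α'(z)) + ι̂^{[v, α(z)]}(z)`. -/
structure IsIota (B : LinearMap.BilinForm ℂ 𝔤) {S : Set ℂ} {z : ℂ} (hz : z ∈ S)
    (i : 𝔤 →ₗ[ℂ] Env 𝔤 S →ₗ[ℂ] Env 𝔤 S) : Prop where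
  map_one : ∀ v, i v 1 = 0
  map_mul : ∀ (v : 𝔤) (α : gMinus 𝔤 S) (x : Env 𝔤 S),
    i v (gen α * x) - gen α * i v x =
      -(gen (divBracket hz v α) * x) - B v (derivAt hz α) • x + i ⁅v, valueAt hz α⁆ x

/-- A subspace of the enveloping algebra which contains `1` and is stable under left multiplication
by generators is everything. -/
theorem env_induction {S : Set ℂ} {p : Env 𝔤 S → Prop} (h1 : p 1)
    (hadd : ∀ x y, p x → p y → p (x + y)) (hsmul : ∀ (c : ℂ) x, p x → p (c • x))
    (hmul : ∀ α x, p x → p (gen α * x)) (x : Env 𝔤 S) : p x := by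
  let A : Subalgebra ℂ (Env 𝔤 S) :=
    { carrier := {a | ∀ y, p y → p (a * y)}
      mul_mem' := fun {a b} ha hb y hy => by rw [mul_assoc]; exact ha _ (hb _ hy)
      add_mem' := fun {a b} ha hb y hy => by rw [add_mul]; exact hadd _ _ (ha _ hy) (hb _ hy)
      algebraMap_mem' := fun c y hy => by rw [← Algebra.smul_def]; exact hsmul _ _ hy }
  let g : gMinus 𝔤 S →ₗ⁅ℂ⁆ A :=
    { toFun := fun α => ⟨gen α, fun y hy => hmul α y hy⟩
      map_add' := fun α β => Subtype.ext (map_add gen α β)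
      map_smul' := fun c α => Subtype.ext (map_smul gen c α)
      map_lie' := fun {α β} => Subtype.ext (LieHom.map_lie gen α β) }
  have hid : A.val.comp (UniversalEnvelopingAlgebra.lift ℂ g) = AlgHom.id ℂ (Env 𝔤 S) := by
    apply UniversalEnvelopingAlgebra.hom_ext
    ext α
    simp [g, gen]
  have hx : x = A.val (UniversalEnvelopingAlgebra.lift ℂ g x) :=
    (DFunLike.congr_fun hid x).symm
  have := (UniversalEnvelopingAlgebra.lift ℂ g x).2 1 h1
  rw [mul_one] at this
  rw [hx]
  exact this

section Iota

variable (B : LinearMap.BilinForm ℂ 𝔤) {S : Set ℂ} {z : ℂ} (hz : z ∈ S)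

/-- Second component of `auxOp`. -/
def auxSnd (α : gMinus 𝔤 S) (x : Env 𝔤 S) (φ : 𝔤 →ₗ[ℂ] Env 𝔤 S) : 𝔤 →ₗ[ℂ] Env 𝔤 S where
  toFun v := gen α * φ v + φ ⁅v, valueAt hz α⁆ - B v (derivAt hz α) • x
      - gen (divBracket hz v α) * x
  map_add' v w := by
    simp only [map_add, add_lie, LinearMap.add_apply, mul_add, add_mul, add_smul]
    abel
  map_smul' c v := by
    simp only [map_smul, smul_lie, LinearMap.smul_apply, smul_mul_assoc, mul_smul_comm,
      RingHom.id_apply, smul_sub, smul_add, smul_eq_mul, mul_smul]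

/-- Auxiliary operator on `U × Hom(𝔤, U)`: left multiplication by `α` on the pairs
`(x, v ↦ ι̂^v(z) x)`. -/
def auxOp (α : gMinus 𝔤 S) : Module.End ℂ (Env 𝔤 S × (𝔤 →ₗ[ℂ] Env 𝔤 S)) where
  toFun m := (gen α * m.1, auxSnd B hz α m.1 m.2)
  map_add' m n := by
    refine Prod.ext (mul_add _ _ _) (LinearMap.ext fun v => ?_)
    change gen α * (m.2 v + n.2 v) + (m.2 _ + n.2 _) - _ • (m.1 + n.1) - _ * (m.1 + n.1) =
      (gen α * m.2 v + m.2 _ - _ • m.1 - _ * m.1) + (gen α * n.2 v + n.2 _ - _ • n.1 - _ * n.1)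
    simp only [mul_add, smul_add]
    abel
  map_smul' c m := by
    refine Prod.ext (mul_smul_comm _ _ _) (LinearMap.ext fun v => ?_)
    change gen α * (c • m.2 v) + (c • m.2 _) - _ • (c • m.1) - _ * (c • m.1) =
      c • (gen α * m.2 v + m.2 _ - _ • m.1 - _ * m.1)
    simp only [mul_smul_comm, smul_add, smul_sub, smul_comm c]

theorem auxOp_fst (α : gMinus 𝔤 S) (m : Env 𝔤 S × (𝔤 →ₗ[ℂ] Env 𝔤 S)) :
    (auxOp B hz α m).1 = gen α * m.1 := rfl

theorem auxOp_snd (α : gMinus 𝔤 S) (m : Env 𝔤 S × (𝔤 →ₗ[ℂ] Env 𝔤 S)) (v : 𝔤) :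
    (auxOp B hz α m).2 v = gen α * m.2 v + m.2 ⁅v, valueAt hz α⁆ - B v (derivAt hz α) • m.1
      - gen (divBracket hz v α) * m.1 := rfl

theorem gen_lie (α β : gMinus 𝔤 S) : gen ⁅α, β⁆ = gen α * gen β - gen β * gen α :=
  LieHom.map_lie gen α β

theorem auxOp_lie (hB : B.lieInvariant 𝔤) (α β : gMinus 𝔤 S)
    (m : Env 𝔤 S × (𝔤 →ₗ[ℂ] Env 𝔤 S)) :
    auxOp B hz ⁅α, β⁆ m = auxOp B hz α (auxOp B hz β m) - auxOp B hz β (auxOp B hz α m) := by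
  refine Prod.ext ?_ (LinearMap.ext fun v => ?_)
  · simp only [auxOp_fst, gen_lie, Prod.fst_sub, sub_mul, mul_assoc]
  · have e1 : B v ⁅derivAt hz α, valueAt hz β⁆ = - B ⁅v, valueAt hz β⁆ (derivAt hz α) := by
      rw [← lie_skew, map_neg, ← lie_skew v, map_neg, LinearMap.neg_apply, hB, neg_neg]
    have e2 : B v ⁅valueAt hz α, derivAt hz β⁆ = B ⁅v, valueAt hz α⁆ (derivAt hz β) := by
      rw [← lie_skew v, map_neg, LinearMap.neg_apply, hB, neg_neg]
    have e3 : m.2 ⁅v, ⁅valueAt hz α, valueAt hz β⁆⁆ =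
        m.2 ⁅⁅v, valueAt hz α⁆, valueAt hz β⁆ - m.2 ⁅⁅v, valueAt hz β⁆, valueAt hz α⁆ := by
      rw [leibniz_lie v, map_add, ← lie_skew (valueAt hz α), map_neg, sub_eq_add_neg]
    simp only [Prod.snd_sub, LinearMap.sub_apply, auxOp_snd, auxOp_fst, gen_lie, valueAt_lie,
      derivAt_lie, divBracket_lie, map_add, map_sub, e1, e2, e3, mul_add, mul_sub, add_mul,
      sub_mul, add_smul, neg_smul, mul_smul_comm, mul_assoc]
    abel

/-- The operators `auxOp` form a representation. -/
def auxRep (hB : B.lieInvariant 𝔤) :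
    gMinus 𝔤 S →ₗ⁅ℂ⁆ Module.End ℂ (Env 𝔤 S × (𝔤 →ₗ[ℂ] Env 𝔤 S)) where
  toFun α := auxOp B hz α
  map_add' α β := by
    refine LinearMap.ext fun m => Prod.ext ?_ (LinearMap.ext fun v => ?_)
    · simp only [LinearMap.add_apply, Prod.fst_add, auxOp_fst, map_add, add_mul]
    · simp only [LinearMap.add_apply, Prod.snd_add, auxOp_snd, map_add, add_mul, lie_add, add_smul]
      abel
  map_smul' c α := by
    refine LinearMap.ext fun m => Prod.ext ?_ (LinearMap.ext fun v => ?_)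
    · simp only [LinearMap.smul_apply, Prod.smul_fst, auxOp_fst, map_smul, smul_mul_assoc,
        RingHom.id_apply]
    · simp only [LinearMap.smul_apply, Prod.smul_snd, auxOp_snd, map_smul, smul_mul_assoc,
        RingHom.id_apply, lie_smul, smul_sub, smul_add, smul_eq_mul, mul_smul]
  map_lie' {α β} := LinearMap.ext fun m => auxOp_lie B hz hB α β m

theorem existsUnique_iota (hB : B.lieInvariant 𝔤) : ∃! i, IsIota B hz i := by
  let L := UniversalEnvelopingAlgebra.lift ℂ (auxRep B hz hB)
  have hL : ∀ α x m, L (gen α * x) m = auxOp B hz α (L x m) := by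
    intro α x m
    rw [map_mul]
    have : L (gen α) = auxOp B hz α := UniversalEnvelopingAlgebra.lift_ι_apply ℂ _ α
    rw [this]
    rfl
  have h1 : ∀ x, (L x (1, 0)).1 = x := by
    intro x
    induction x using env_induction with
    | h1 => simp
    | hadd x y hx hy => simp [hx, hy]
    | hsmul c x hx => simp [hx]
    | hmul α x hx => rw [hL, auxOp_fst, hx]
  refine ⟨LinearMap.mk₂ ℂ (fun v x => (L x (1, 0)).2 v) (by simp) (by simp) (by simp) (by simp),
    ⟨?_, ?_⟩, ?_⟩
  · intro v
    simp
  · intro v α x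
    simp only [LinearMap.mk₂_apply, hL, auxOp_snd, h1]
    abel
  · intro i hi
    refine LinearMap.ext fun v => LinearMap.ext fun x => ?_
    induction x using env_induction generalizing v with
    | h1 => simp [hi.map_one]
    | hadd x y hx hy => simp only [map_add, hx, hy]
    | hsmul c x hx => simp only [map_smul, hx]
    | hmul α x hx =>
      rw [sub_eq_iff_eq_add.1 (hi.map_mul v α x), hx v, hx ⁅v, valueAt hz α⁆]
      simp only [LinearMap.mk₂_apply, hL, auxOp_snd, h1]
      abel

/-- The field `ι̂^v(z)`, the unique solution of the conditions `IsIota`. -/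
def iota (hB : B.lieInvariant 𝔤) : 𝔤 →ₗ[ℂ] Env 𝔤 S →ₗ[ℂ] Env 𝔤 S :=
  (existsUnique_iota B hz hB).choose

theorem isIota_iota (hB : B.lieInvariant 𝔤) : IsIota B hz (iota B hz hB) :=
  (existsUnique_iota B hz hB).choose_spec.1

/-- The current `ĵ^v(z) = ε̂^v(z) + ι̂^v(z)`. -/
def current (hB : B.lieInvariant 𝔤) {T : Set ℂ} (h : T ⊆ S) (hzT : z ∉ T) (v : 𝔤) :
    Env 𝔤 S →ₗ[ℂ] Env 𝔤 T :=
  epsilon T hzT v ∘ₗ (restr h).toLinearMap + (restr h).toLinearMap ∘ₗ iota B hz hB v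

end Iota

/-! ### Regular families and limits -/

/-- A family `a(t)`, `t ∈ V`, of rational functions of `u`, vanishing at `u = ∞`, which is given by
a single rational function of `(u, t)` whose poles lie on the diagonal `u = t` and on
finitely many lines `u = const`. -/
def IsFunctionFamily (V : Set ℂ) (a : V → vanishing ∅) : Prop :=
  ∃ (p : ℂ[X][X]) (n : ℕ) (h k : ℂ[X]), h ≠ 0 ∧ (∀ t ∈ V, k.eval t ≠ 0) ∧
    p.degree < ((n + h.natDegree : ℕ) : WithBot ℕ) ∧
    ∀ t : V, (a t : RatFunc ℂ) =
      algebraMap ℂ[X] (RatFunc ℂ) (p.map (evalRingHom (t : ℂ))) /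
        algebraMap ℂ[X] (RatFunc ℂ) (C (k.eval (t : ℂ)) * ((X - C (t : ℂ)) ^ n * h))

/-- Families of vectors of `U𝔤₋` varying regularly over `V`: the algebra generated by the
functions regular on `V` and by families of the form `x ⊗ a(t)`. -/
def regularFamilies (𝔤 : Type*) [LieRing 𝔤] [LieAlgebra ℂ 𝔤] (V : Set ℂ) :
    Subalgebra ℂ (V → Env 𝔤 ∅) :=
  Algebra.adjoin ℂ
    ({F | ∃ (x : 𝔤) (a : V → vanishing ∅), IsFunctionFamily V a ∧ F = fun t => gen (tens x (a t))} ∪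
     {F | ∃ p k : ℂ[X], (∀ t ∈ V, k.eval t ≠ 0) ∧
        F = fun t : V => algebraMap ℂ (Env 𝔤 ∅) (p.eval (t : ℂ) / k.eval (t : ℂ))})

/-- The family `G`, given away from `z`, extends to a regular family over `V`, and the extension
takes the value `w` at `z`. -/
def HasLimit {V : Set ℂ} {z : ℂ} (hz : z ∈ V) (G : (V \ {z} : Set ℂ) → Env 𝔤 ∅) (w : Env 𝔤 ∅) :
    Prop :=
  ∃ F ∈ regularFamilies 𝔤 V, (∀ t : (V \ {z} : Set ℂ), F ⟨t, t.2.1⟩ = G t) ∧ F ⟨z, hz⟩ = w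

/-- `w` is the derivative at `z` of the family `t ↦ ι̂^v(t) y`, where `y` is built out of functions
regular on `V`: the limit of the difference quotients. -/
def HasIotaDeriv (B : LinearMap.BilinForm ℂ 𝔤) (hB : B.lieInvariant 𝔤) {V : Set ℂ} {z : ℂ}
    (hz : z ∈ V) (v : 𝔤) (y : Env 𝔤 V) (w : Env 𝔤 ∅) : Prop :=
  HasLimit hz (fun t => ((t : ℂ) - z)⁻¹ •
    (restr (Set.empty_subset V) (iota B t.2.1 hB v y) -
      restr (Set.empty_subset V) (iota B hz hB v y))) w

end LieAlg

end CurrentAlgebra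
end

open CurrentAlgebra

noncomputable section

namespace CurrentAlgebra

section Currents

attribute [local instance 100] LieRing.ofAssociativeRing

variable {𝔤 : Type*} [LieRing 𝔤] [LieAlgebra ℂ 𝔤]

/-! ### Compatibility with restriction -/

/-! Everything is reduced to commutators with left multiplications: by `env_induction` an operator
on the enveloping algebra is determined by its value on `1` and by how it passes each generator `α`.
Separately, `ε̂` and `ι̂` have complicated commutators with `α`, but the divided difference `[v, (α
- α(z)) / (u - z)]` occurs in them with opposite signs. For the current, only `ĵ^{[v, α(z)]}(z) -
(v, α'(z))` remains (`current_gen_mul`).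

Commutativity (`current_comm`): moving `α` to the left through `ĵ^{v₁}(z₁) ĵ^{v₂}(z₂)` produces
terms that are symmetric under exchange of the two currents, so only the vector `1` has to be
checked. There the claim is the partial fraction expansion of `1 / ((u - z₁)(u - z₂))` together with
the symmetry of the form.

Operator product: `v₁ / (u - z)` is regular at `t ≠ z`, so `ι̂^{v₂}(t)` can be moved past it by the
defining relation. The derivative term gives the double pole, and the divided difference gives the
`ε̂` part of the simple pole. The value term gives `ι̂^{[v₂,v₁]}(t) / (t - z)`, which combines with
the subtracted `ι̂^{[v₂,v₁]}(z) / (t - z)` into a difference quotient. This is an exact identity for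
`t ≠ z` (`current_current_sub`). The limit then needs two facts: `t ↦ ι̂^v(t) y` is a regular family
(`iota_mem_regularFamilies`), and difference quotients of regular families extend regularly
(`exists_slope_of_mem_regularFamilies`). -/

theorem restr_gen {S T : Set ℂ} (h : T ⊆ S) (α : gMinus 𝔤 S) :
    restr h (gen α) = gen (incl h α) :=
  UniversalEnvelopingAlgebra.lift_ι_apply ℂ _ α

theorem incl_incl {S T R : Set ℂ} (h : T ⊆ S) (h' : R ⊆ T) (α : gMinus 𝔤 S) :
    incl h' (incl h α) = incl (h'.trans h) α := by
  induction α using gMinus_induction with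
  | h0 => simp
  | h1 x f => rfl
  | h2 α β hα hβ => simp only [map_add, hα, hβ]

theorem restr_restr {S T R : Set ℂ} (h : T ⊆ S) (h' : R ⊆ T) (x : Env 𝔤 S) :
    restr h' (restr h x) = restr (h'.trans h) x := by
  induction x using env_induction with
  | h1 => simp
  | hadd x y hx hy => simp only [map_add, hx, hy]
  | hsmul c x hx => simp only [map_smul, hx]
  | hmul α x hx => simp only [map_mul, restr_gen, incl_incl, hx]

/-! ### Independence of the local data at `z` from the set of regular points. -/

section Naturality

variable {S T : Set ℂ} (h : T ⊆ S) {z : ℂ}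

theorem valueAt_incl (hz : z ∈ S) (hzT : z ∈ T) (α : gMinus 𝔤 S) :
    valueAt hzT (incl h α) = valueAt hz α := by
  induction α using gMinus_induction with
  | h0 => simp
  | h1 x f => rfl
  | h2 α β hα hβ => simp only [map_add, hα, hβ]

theorem derivAt_incl (hz : z ∈ S) (hzT : z ∈ T) (α : gMinus 𝔤 S) :
    derivAt hzT (incl h α) = derivAt hz α := by
  induction α using gMinus_induction with
  | h0 => simp
  | h1 x f => rfl
  | h2 α β hα hβ => simp only [map_add, hα, hβ]

theorem divBracket_incl (hz : z ∈ S) (hzT : z ∈ T) (v : 𝔤) (α : gMinus 𝔤 S) :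
    divBracket hzT v (incl h α) = incl h (divBracket hz v α) := by
  induction α using gMinus_induction with
  | h0 => simp
  | h1 x f => rfl
  | h2 α β hα hβ => simp only [map_add, hα, hβ]

theorem incl_polePart (hz : z ∉ S) (hzT : z ∉ T) (v : 𝔤) :
    incl h (polePart S hz v) = polePart T hzT v := rfl

end Naturality

/-! ### Moving `ι̂` and the current past a left multiplication. -/

section Iota

variable (B : LinearMap.BilinForm ℂ 𝔤) (hB : B.lieInvariant 𝔤)

theorem iota_one {S : Set ℂ} {z : ℂ} (hz : z ∈ S) (v : 𝔤) : iota B hz hB v 1 = 0 :=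
  (isIota_iota B hz hB).map_one v

theorem iota_gen_mul {S : Set ℂ} {z : ℂ} (hz : z ∈ S) (v : 𝔤) (α : gMinus 𝔤 S) (x : Env 𝔤 S) :
    iota B hz hB v (gen α * x) = gen α * iota B hz hB v x - gen (divBracket hz v α) * x
      - B v (derivAt hz α) • x + iota B hz hB ⁅v, valueAt hz α⁆ x := by
  rw [sub_eq_iff_eq_add.1 ((isIota_iota B hz hB).map_mul v α x)]
  abel

/-- The value, derivative and divided difference of `α` at `z` do not depend on the set of regular
points, so both sides obey the same recursion. This allows the neighbourhood to be changed freely.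
-/
theorem restr_iota {S T : Set ℂ} (h : T ⊆ S) {z : ℂ} (hz : z ∈ S) (hzT : z ∈ T) (v : 𝔤)
    (x : Env 𝔤 S) : restr h (iota B hz hB v x) = iota B hzT hB v (restr h x) := by
  induction x using env_induction generalizing v with
  | h1 => simp only [map_one, iota_one, map_zero]
  | hadd x y hx hy => simp only [map_add, hx, hy]
  | hsmul c x hx => simp only [map_smul, hx]
  | hmul α x hx =>
    simp only [iota_gen_mul, map_add, map_sub, map_mul, map_smul, restr_gen, hx,
      valueAt_incl h hz hzT, derivAt_incl h hz hzT, divBracket_incl h hz hzT]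

theorem current_apply {S T : Set ℂ} (h : T ⊆ S) {z : ℂ} (hz : z ∈ S) (hzT : z ∉ T) (v : 𝔤)
    (x : Env 𝔤 S) : current B hz hB h hzT v x =
      gen (polePart T hzT v) * restr h x + restr h (iota B hz hB v x) := rfl

theorem current_one {S T : Set ℂ} (h : T ⊆ S) {z : ℂ} (hz : z ∈ S) (hzT : z ∉ T) (v : 𝔤) :
    current B hz hB h hzT v 1 = gen (polePart T hzT v) := by
  rw [current_apply, iota_one, map_one, map_zero, mul_one, add_zero]

theorem current_smul {S T : Set ℂ} (h : T ⊆ S) {z : ℂ} (hz : z ∈ S) (hzT : z ∉ T) (c : ℂ) (v : 𝔤)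
    (x : Env 𝔤 S) : current B hz hB h hzT (c • v) x = c • current B hz hB h hzT v x := by
  simp only [current_apply, map_smul, smul_mul_assoc, LinearMap.smul_apply, smul_add]

/-- The commutation relation of the current with left multiplications. -/
theorem current_gen_mul {S T : Set ℂ} (h : T ⊆ S) {z : ℂ} (hz : z ∈ S) (hzT : z ∉ T) (v : 𝔤)
    (α : gMinus 𝔤 S) (x : Env 𝔤 S) :
    current B hz hB h hzT v (gen α * x) = gen (incl h α) * current B hz hB h hzT v x
      + current B hz hB h hzT ⁅v, valueAt hz α⁆ x - B v (derivAt hz α) • restr h x := by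
  -- The divided difference equals `[v / (u - z), α]` minus the pole part of `[v, α(z)]`;
  -- substituting this turns the `ι̂` correction into the missing `ε̂` terms.
  have hp := congrArg gen (polePart_lie h hz hzT v α)
  rw [map_sub, gen_lie] at hp
  simp only [current_apply, iota_gen_mul, map_add, map_sub, map_mul, map_smul, restr_gen, ← hp,
    mul_add, sub_mul, mul_assoc]
  abel

/-- The scalar term of one current leaves a bare restriction next to the other current; this
compares the resulting terms when the two are composed in opposite orders. -/
theorem restr_current {S T S' T' : Set ℂ} (h : T ⊆ S) (h' : T' ⊆ S') (hS : S' ⊆ S) (hT : T' ⊆ T)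
    {z : ℂ} (hz : z ∈ S) (hz' : z ∈ S') (hzT : z ∉ T) (hzT' : z ∉ T') (v : 𝔤) (x : Env 𝔤 S) :
    restr hT (current B hz hB h hzT v x) = current B hz' hB h' hzT' v (restr hS x) := by
  simp only [current_apply, map_add, map_mul, restr_gen, restr_restr, incl_polePart hT hzT hzT',
    ← restr_iota B hB hS hz hz']

/-! ### Commutativity of the currents -/

/-- Evaluation is defined through the reduced fraction; its denominator divides `q`, hence is
nonzero at `w`, and cross-multiplication compares the two quotients. -/
theorem val_div {p q : ℂ[X]} {w : ℂ} (hq : q.eval w ≠ 0) :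
    val w (algebraMap ℂ[X] (RatFunc ℂ) p / algebraMap ℂ[X] (RatFunc ℂ) q) =
      p.eval w / q.eval w := by
  have hq0 : q ≠ 0 := by rintro rfl; simp at hq
  set f := algebraMap ℂ[X] (RatFunc ℂ) p / algebraMap ℂ[X] (RatFunc ℂ) q with hf
  have hd : f.denom.eval w ≠ 0 := fun h =>
    hq (eval_eq_zero_of_dvd_of_eval_eq_zero ((RatFunc.denom_dvd hq0).2 ⟨p, hf⟩) h)
  have hcross := congrArg (eval w) ((RatFunc.num_mul_eq_mul_denom_iff hq0).2 hf)
  rw [eval_mul, eval_mul] at hcross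
  change f.num.eval w / f.denom.eval w = _
  rw [div_eq_div_iff hd hq, hcross]

theorem val_pole {z w : ℂ} (hw : w ≠ z) : val w (RatFunc.X - RatFunc.C z)⁻¹ = (w - z)⁻¹ := by
  have h := val_div (p := 1) (q := X - C z) (w := w) (by simpa [sub_eq_zero] using hw)
  simpa using h

theorem der_pole {z w : ℂ} (hw : w ≠ z) :
    der w (RatFunc.X - RatFunc.C z)⁻¹ = -((w - z) ^ 2)⁻¹ := by
  have h : HasDerivAt (fun t : ℂ => (t - z)⁻¹) (-1 / (w - z) ^ 2) w :=
    ((hasDerivAt_id w).sub_const z).fun_inv (sub_ne_zero.2 hw)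
  rw [neg_div, one_div] at h
  refine (Filter.EventuallyEq.deriv_eq ?_).trans h.deriv
  filter_upwards [eventually_ne_nhds hw] with t ht
  exact val_pole ht

theorem valueAt_polePart {S : Set ℂ} {z w : ℂ} (hw : w ∈ S) (hz : z ∉ S) (v : 𝔤) :
    valueAt hw (polePart S hz v) = (w - z)⁻¹ • v := by
  change val w (RatFunc.X - RatFunc.C z)⁻¹ • v = _
  rw [val_pole (ne_of_mem_of_not_mem hw hz)]

theorem derivAt_polePart {S : Set ℂ} {z w : ℂ} (hw : w ∈ S) (hz : z ∉ S) (v : 𝔤) :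
    derivAt hw (polePart S hz v) = -((w - z) ^ 2)⁻¹ • v := by
  change der w (RatFunc.X - RatFunc.C z)⁻¹ • v = _
  rw [der_pole (ne_of_mem_of_not_mem hw hz)]

/-- Partial fractions: the pointwise bracket multiplies the two simple poles. -/
theorem lie_polePart {z₁ z₂ : ℂ} (hne : z₁ ≠ z₂) {T : Set ℂ} (h₁ : z₁ ∉ T) (h₂ : z₂ ∉ T)
    (v₁ v₂ : 𝔤) :
    ⁅polePart T h₁ v₁, polePart T h₂ v₂⁆ =
      (z₁ - z₂)⁻¹ • (polePart T h₁ ⁅v₁, v₂⁆ - polePart T h₂ ⁅v₁, v₂⁆) := by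
  change tens ⁅v₁, v₂⁆ (pole T z₁ h₁ * pole T z₂ h₂) = _ • (tens ⁅v₁, v₂⁆ _ - tens ⁅v₁, v₂⁆ _)
  rw [sub_eq_add_neg (tens _ _), ← neg_one_smul ℂ (tens _ _), ← pure_smul, ← pure_add, ← pure_smul]
  congr 1
  apply Subtype.ext
  change (RatFunc.X - RatFunc.C z₁)⁻¹ * (RatFunc.X - RatFunc.C z₂)⁻¹ =
    (z₁ - z₂)⁻¹ • ((RatFunc.X - RatFunc.C z₁)⁻¹ + (-1 : ℂ) • (RatFunc.X - RatFunc.C z₂)⁻¹)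
  have e₁ := X_sub_C_ne_zero' z₁
  have e₂ := X_sub_C_ne_zero' z₂
  have e₃ : (RatFunc.C z₁ - RatFunc.C z₂ : RatFunc ℂ) ≠ 0 :=
    sub_ne_zero.2 (RatFunc.C_injective.ne hne)
  rw [neg_one_smul, RatFunc.smul_eq_C_mul, map_inv₀, map_sub]
  field_simp
  ring

theorem current_comm (hsymm : B.IsSymm) {z₁ z₂ : ℂ} (hne : z₁ ≠ z₂) {S T₁ T₂ T : Set ℂ}
    (hz₁ : z₁ ∈ S) (hz₂ : z₂ ∈ S) (h₁ : T₁ ⊆ S) (h₂ : T₂ ⊆ S) (hz₁₁ : z₁ ∈ T₁) (hz₂₁ : z₂ ∉ T₁)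
    (hz₂₂ : z₂ ∈ T₂) (hz₁₂ : z₁ ∉ T₂) (hT₁ : T ⊆ T₁) (hT₂ : T ⊆ T₂) (v₁ v₂ : 𝔤) (x : Env 𝔤 S) :
    current B hz₁₁ hB hT₁ (fun h => hz₁₂ (hT₂ h)) v₁ (current B hz₂ hB h₁ hz₂₁ v₂ x) =
      current B hz₂₂ hB hT₂ (fun h => hz₂₁ (hT₁ h)) v₂ (current B hz₁ hB h₂ hz₁₂ v₁ x) := by
  induction x using env_induction generalizing v₁ v₂ with
  | h1 =>
    have e₁ : B v₂ v₁ = B v₁ v₂ := hsymm.eq v₂ v₁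
    have e₂ : (z₂ - z₁)⁻¹ = -(z₁ - z₂)⁻¹ := by rw [← neg_sub, inv_neg]
    have e₃ : (z₂ - z₁) ^ 2 = (z₁ - z₂) ^ 2 := by ring
    have hp := congrArg gen (lie_polePart hne (fun h => hz₁₂ (hT₂ h)) (fun h => hz₂₁ (hT₁ h)) v₁ v₂)
    rw [gen_lie, map_smul, map_sub] at hp
    -- Inserting a factor `1` lets each outer current pass the pole part created by the inner one,
    -- which is regular at the outer point.
    rw [current_one, current_one, ← mul_one (gen (polePart T₁ _ _)),
      ← mul_one (gen (polePart T₂ _ _)), current_gen_mul, current_gen_mul, valueAt_polePart,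
      valueAt_polePart, derivAt_polePart, derivAt_polePart, lie_smul, lie_smul, current_smul,
      current_smul, current_one, current_one, current_one, current_one, ← lie_skew v₁ v₂, map_neg,
      map_neg, map_smul, map_smul, e₁, e₂, e₃, incl_polePart hT₁ _ (fun h => hz₂₁ (hT₁ h)),
      incl_polePart hT₂ _ (fun h => hz₁₂ (hT₂ h)), map_one, map_one, ← sub_eq_zero]
    -- All brackets are brought to the order `⁅v₂, v₁⁆`, so that what is left is linear.
    rw [← lie_skew v₁ v₂, map_neg, map_neg, map_neg, map_neg] at hp
    rw [sub_eq_iff_eq_add] at hp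
    rw [hp]
    simp only [neg_smul, smul_neg, smul_sub]
    abel
  | hadd x y hx hy => simp only [map_add, hx, hy]
  | hsmul c x hx => simp only [map_smul, hx]
  | hmul α x hx =>
    -- Both orders expand to the same terms; the induction hypothesis is used also with `v₁` or `v₂`
    -- replaced by its bracket with the value of `α`.
    simp only [current_gen_mul, map_add, map_sub, map_smul, valueAt_incl h₁ hz₁ hz₁₁,
      valueAt_incl h₂ hz₂ hz₂₂, derivAt_incl h₁ hz₁ hz₁₁, derivAt_incl h₂ hz₂ hz₂₂, incl_incl, hx,
      restr_current B hB h₁ hT₂ h₂ hT₁ hz₂ hz₂₂ hz₂₁ (fun h => hz₂₁ (hT₁ h)),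
      restr_current B hB h₂ hT₁ h₁ hT₂ hz₁ hz₁₁ hz₁₂ (fun h => hz₁₂ (hT₂ h))]
    abel

end Iota

/-! ### Regular families -/

section Families

variable {V : Set ℂ}

theorem eq_num_div_denom (f : RatFunc ℂ) :
    f = algebraMap ℂ[X] (RatFunc ℂ) f.num / algebraMap ℂ[X] (RatFunc ℂ) f.denom :=
  (RatFunc.num_div_denom f).symm

theorem isFunctionFamily_const (f : vanishing ∅) : IsFunctionFamily V fun _ => f := by
  refine ⟨(f : RatFunc ℂ).num.map C, 0, (f : RatFunc ℂ).denom, 1, RatFunc.denom_ne_zero _, by simp,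
    ?_, fun t => ?_⟩
  · rw [zero_add, ← degree_eq_natDegree (RatFunc.denom_ne_zero _)]
    exact (degree_map_le).trans_lt f.2.1
  · have : (evalRingHom (t : ℂ)).comp C = RingHom.id ℂ := by ext; simp
    simp [Polynomial.map_map, this, RatFunc.num_div_denom]

theorem isFunctionFamily_pole : IsFunctionFamily V fun t => pole ∅ t (Set.notMem_empty _) := by
  refine ⟨1, 1, 1, 1, one_ne_zero, by simp, by simp, fun t => ?_⟩
  change (RatFunc.X - RatFunc.C (t : ℂ))⁻¹ = _
  simp

theorem isFunctionFamily_divDiff (f : vanishing V) :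
    IsFunctionFamily V fun t : V => ⟨divDiff t.2 f, vanishing_mono (Set.empty_subset V)
      (divDiff t.2 f).2⟩ := by
  obtain ⟨g, hg⟩ := f
  have hcomp : ∀ t : ℂ, (evalRingHom t).comp C = RingHom.id ℂ := fun t => by ext; simp
  have hd0 := RatFunc.denom_ne_zero g
  -- In `ℂ[X][X]` the outer variable is `u` and the coefficients are polynomials in `t`. The witness
  -- is the numerator of `g(u) - g(t)` over the common denominator; the removable pole on `u = t` is
  -- kept as `n = 1`, which also makes the degree bound strict.
  refine ⟨g.num.map C * C g.denom - C g.num * g.denom.map C, 1, g.denom, g.denom, hd0,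
    fun t ht => hg.2 t ht, ?_, fun t => ?_⟩
  · refine lt_of_le_of_lt (b := (g.denom.natDegree : WithBot ℕ)) ?_ (by norm_cast; omega)
    rw [← degree_eq_natDegree hd0]
    refine (degree_sub_le _ _).trans (max_le ?_ ?_)
    · refine (degree_mul_le _ _).trans ?_
      calc _ ≤ g.num.degree + 0 := add_le_add degree_map_le degree_C_le
        _ ≤ _ := by rw [add_zero]; exact hg.1.le
    · refine (degree_mul_le _ _).trans ?_
      calc _ ≤ 0 + g.denom.degree := add_le_add degree_C_le degree_map_le
        _ = _ := zero_add _
  · have hk : g.denom.eval (t : ℂ) ≠ 0 := hg.2 t t.2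
    change (g - RatFunc.C (g.num.eval (t : ℂ) / g.denom.eval (t : ℂ))) /
      (RatFunc.X - RatFunc.C (t : ℂ)) = _
    simp only [Polynomial.map_sub, Polynomial.map_mul, Polynomial.map_map, hcomp, Polynomial.map_C,
      Polynomial.map_id, coe_evalRingHom, map_sub, map_mul, RatFunc.algebraMap_C,
      RatFunc.algebraMap_X, pow_one, map_div₀]
    have h1 := X_sub_C_ne_zero' (t : ℂ)
    have h2 := algebraMap_ne_zero hd0
    have h3 : (RatFunc.C (g.denom.eval (t : ℂ)) : RatFunc ℂ) ≠ 0 := by simpa using hk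
    have h4 : g * algebraMap ℂ[X] (RatFunc ℂ) g.denom = algebraMap ℂ[X] (RatFunc ℂ) g.num := by
      nth_rewrite 1 [eq_num_div_denom g]
      exact div_mul_cancel₀ _ h2
    rw [← h4]
    field_simp

/-- The difference quotients of a function family form a function family. -/
theorem IsFunctionFamily.exists_slope {a : V → vanishing ∅} (ha : IsFunctionFamily V a) (z : V) :
    ∃ b : V → vanishing ∅, IsFunctionFamily V b ∧ ∀ t : V, ((t : ℂ) - z) • b t = a t - a z := by
  obtain ⟨p, n, h, k, hh, hk, hp, hpa⟩ := ha
  -- `N` is the numerator of `a(t) - a(z)` over the common denominator, with `X` standing for `u`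
  -- and `C X` for `t`.
  let N : ℂ[X][X] := C (C (k.eval (z : ℂ))) * (X - C (C (z : ℂ))) ^ n * p -
    C k * (X - C X) ^ n * (p.map (evalRingHom (z : ℂ))).map C
  have hNt : ∀ t : ℂ, N.map (evalRingHom t) = C (k.eval (z : ℂ)) * (X - C (z : ℂ)) ^ n *
      p.map (evalRingHom t) - C (k.eval t) * (X - C t) ^ n * p.map (evalRingHom (z : ℂ)) := by
    intro t
    have hcomp : (evalRingHom t).comp C = RingHom.id ℂ := by ext; simp
    simp only [N, Polynomial.map_sub, Polynomial.map_mul, Polynomial.map_pow, Polynomial.map_C,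
      Polynomial.map_X, coe_evalRingHom, eval_C, eval_X, Polynomial.map_map _ (evalRingHom t),
      hcomp, Polynomial.map_id]
  -- `N` vanishes at `t = z`, so each of its coefficients in `u` is divisible by `t - z`.
  obtain ⟨q, hq⟩ : C (X - C (z : ℂ)) ∣ N := by
    rw [C_dvd_iff_dvd_coeff]
    intro i
    rw [dvd_iff_isRoot, IsRoot, ← coe_evalRingHom, ← coeff_map, hNt, sub_self, coeff_zero]
  have hNdeg : N.degree < ((n + (n + h.natDegree) : ℕ) : WithBot ℕ) := by
    have hlt : ∀ (c : ℂ[X]) (d : ℂ[X]) (r : ℂ[X][X]),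
        r.degree < ((n + h.natDegree : ℕ) : WithBot ℕ) →
        (C c * (X - C d) ^ n * r).degree < ((n + (n + h.natDegree) : ℕ) : WithBot ℕ) := by
      intro c d r hr
      refine (degree_mul_le _ _).trans_lt ?_
      have h1 : (C c * (X - C d) ^ n).degree ≤ (n : WithBot ℕ) := by
        refine (degree_mul_le _ _).trans ?_
        rw [degree_pow, degree_X_sub_C, nsmul_one]
        calc _ ≤ (0 : WithBot ℕ) + n := add_le_add degree_C_le le_rfl
          _ = n := zero_add _
      rw [Nat.cast_add]
      exact (add_le_add h1 le_rfl).trans_lt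
        (WithBot.add_lt_add_left (WithBot.natCast_ne_bot n) hr)
    refine (degree_sub_le _ _).trans_lt (max_lt (hlt _ _ _ hp) (hlt _ _ _ ?_))
    exact degree_map_le.trans_lt (degree_map_le.trans_lt hp)
  have hqdeg : q.degree < ((n + ((X - C (z : ℂ)) ^ n * h).natDegree : ℕ) : WithBot ℕ) := by
    rw [((monic_X_sub_C (z : ℂ)).pow n).natDegree_mul' hh, natDegree_pow, natDegree_X_sub_C,
      mul_one]
    rwa [hq, degree_mul, degree_C (X_sub_C_ne_zero _), zero_add] at hNdeg
  -- The denominator of the fixed function `a(z)` adds the line `u = z` to the fixed poles and the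
  -- constant `k(z)` to the `t`-denominator.
  have hh' : (X - C (z : ℂ)) ^ n * h ≠ 0 := mul_ne_zero (pow_ne_zero _ (X_sub_C_ne_zero _)) hh
  let K : ℂ[X] := k * C (k.eval (z : ℂ))
  have hK : ∀ t ∈ V, K.eval t ≠ 0 := fun t ht => by
    simpa [K] using ⟨hk t ht, hk z z.2⟩
  let b : V → vanishing ∅ := fun t =>
    ⟨algebraMap ℂ[X] (RatFunc ℂ) (q.map (evalRingHom (t : ℂ))) /
        algebraMap ℂ[X] (RatFunc ℂ)
          (C (K.eval (t : ℂ)) * ((X - C (t : ℂ)) ^ n * ((X - C (z : ℂ)) ^ n * h))), by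
      refine vanishReg_of_eq _ _ (degree_map_le.trans_lt ?_) (by simp) rfl
      rwa [degree_C_mul (hK t t.2), degree_mul, degree_pow, degree_X_sub_C, nsmul_one, degree_eq_natDegree hh',
        ← Nat.cast_add]⟩
  refine ⟨b, ⟨q, n, _, K, hh', hK, hqdeg, fun t => rfl⟩, fun t => Subtype.ext ?_⟩
  have hqt := congrArg (algebraMap ℂ[X] (RatFunc ℂ))
    ((congrArg (Polynomial.map (evalRingHom (t : ℂ))) hq).symm.trans (hNt t))
  change ((t : ℂ) - z) • (_ / _) = (a t : RatFunc ℂ) - a z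
  rw [hpa, hpa, RatFunc.smul_eq_C_mul]
  simp only [K, Polynomial.map_mul, Polynomial.map_sub, Polynomial.map_C, coe_evalRingHom, eval_mul, eval_C,
    eval_X, map_sub, map_mul, map_pow, RatFunc.algebraMap_C, RatFunc.algebraMap_X] at hqt ⊢
  have e1 := X_sub_C_ne_zero' (t : ℂ)
  have e2 := X_sub_C_ne_zero' (z : ℂ)
  have e3 := algebraMap_ne_zero hh
  have e4 : (RatFunc.C (k.eval (t : ℂ)) : RatFunc ℂ) ≠ 0 := by simpa using hk t t.2
  have e5 : (RatFunc.C (k.eval (z : ℂ)) : RatFunc ℂ) ≠ 0 := by simpa using hk z z.2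
  rw [← mul_div_assoc, hqt]
  field_simp

theorem gen_tens_mem_regularFamilies (x : 𝔤) {a : V → vanishing ∅} (ha : IsFunctionFamily V a) :
    (fun t => gen (tens x (a t))) ∈ regularFamilies 𝔤 V :=
  Algebra.subset_adjoin (Or.inl ⟨x, a, ha, rfl⟩)

theorem algebraMap_mem_regularFamilies {p k : ℂ[X]} (hk : ∀ t ∈ V, k.eval t ≠ 0) :
    (fun t : V => algebraMap ℂ (Env 𝔤 ∅) (p.eval (t : ℂ) / k.eval (t : ℂ))) ∈
      regularFamilies 𝔤 V :=
  Algebra.subset_adjoin (Or.inr ⟨p, k, hk, rfl⟩)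

theorem smul_mem_regularFamilies {p k : ℂ[X]} (hk : ∀ t ∈ V, k.eval t ≠ 0) {F : V → Env 𝔤 ∅}
    (hF : F ∈ regularFamilies 𝔤 V) :
    (fun t : V => (p.eval (t : ℂ) / k.eval (t : ℂ)) • F t) ∈ regularFamilies 𝔤 V := by
  simp only [Algebra.smul_def]
  exact mul_mem (algebraMap_mem_regularFamilies hk) hF

/-- A fixed rational function of `u` has its poles on finitely many lines `u = const`, which
function families allow. -/
theorem const_mem_regularFamilies (w : Env 𝔤 ∅) : (fun _ => w) ∈ regularFamilies 𝔤 V := by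
  induction w using env_induction with
  | h1 => exact one_mem _
  | hadd x y hx hy => exact add_mem hx hy
  | hsmul c x hx => exact Subalgebra.smul_mem _ hx c
  | hmul α x hx =>
    suffices hα : (fun _ : V => gen α) ∈ regularFamilies 𝔤 V from mul_mem hα hx
    induction α using gMinus_induction with
    | h0 =>
      simp only [map_zero]
      exact zero_mem _
    | h1 x f => exact gen_tens_mem_regularFamilies x (isFunctionFamily_const f)
    | h2 α β hα hβ =>
      simp only [map_add]
      exact add_mem hα hβ

/-- Regular families have regular difference quotients. -/
theorem exists_slope_of_mem_regularFamilies {F : V → Env 𝔤 ∅} (hF : F ∈ regularFamilies 𝔤 V)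
    (z : V) : ∃ G ∈ regularFamilies 𝔤 V, ∀ t : V, ((t : ℂ) - z) • G t = F t - F z := by
  induction hF using Algebra.adjoin_induction with
  | mem F hF =>
    rcases hF with ⟨x, a, ha, rfl⟩ | ⟨p, k, hk, rfl⟩
    · obtain ⟨b, hb, hab⟩ := ha.exists_slope z
      refine ⟨_, gen_tens_mem_regularFamilies x hb, fun t => ?_⟩
      rw [← map_smul, ← pure_smul, hab, sub_eq_add_neg, pure_add, map_add,
        ← neg_one_smul ℂ (a z), pure_smul, map_smul, neg_one_smul, ← sub_eq_add_neg]
    -- The numerator of `p(t)/k(t) - p(z)/k(z)` has the root `t = z`.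
    · obtain ⟨q, hq⟩ : (X - C (z : ℂ)) ∣ p * C (k.eval (z : ℂ)) - C (p.eval (z : ℂ)) * k := by
        rw [dvd_iff_isRoot]
        simp [mul_comm]
      refine ⟨_, algebraMap_mem_regularFamilies (p := q) (k := k * C (k.eval (z : ℂ)))
        fun t ht => by simpa using ⟨hk t ht, hk z z.2⟩, fun t => ?_⟩
      have hqt := congrArg (eval (t : ℂ)) hq
      simp only [eval_sub, eval_mul, eval_C, eval_X] at hqt
      have e1 := hk t t.2
      have e2 := hk z z.2
      rw [← map_sub, ← algebraMap_smul (Env 𝔤 ∅) ((t : ℂ) - z), smul_eq_mul, ← map_mul]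
      congr 1
      rw [eval_mul, eval_C, ← mul_div_assoc, ← hqt]
      field_simp
  | algebraMap c => exact ⟨0, zero_mem _, fun t => by simp [Pi.algebraMap_apply]⟩
  | add F F' _ _ hF hF' =>
    obtain ⟨G, hG, e⟩ := hF
    obtain ⟨G', hG', e'⟩ := hF'
    refine ⟨G + G', add_mem hG hG', fun t => ?_⟩
    simp only [Pi.add_apply, smul_add, e, e']
    abel
  | mul F F' _ hF'mem hF hF' =>
    obtain ⟨G, hG, e⟩ := hF
    obtain ⟨G', hG', e'⟩ := hF'
    -- Noncommutative product rule: `F(t)F'(t) - F(z)F'(z) = (F(t) - F(z))F'(t) + F(z)(F'(t) -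
    -- F'(z))`.
    refine ⟨G * F' + (fun _ => F z) * G', add_mem (mul_mem hG hF'mem)
      (mul_mem (const_mem_regularFamilies _) hG'), fun t => ?_⟩
    simp only [Pi.add_apply, Pi.mul_apply]
    rw [smul_add, ← smul_mul_assoc, ← mul_smul_comm, e, e', sub_mul, mul_sub]
    abel

/-! ### Regular dependence of `ι̂^v(t) y` on the point `t`. -/

variable (B : LinearMap.BilinForm ℂ 𝔤) (hB : B.lieInvariant 𝔤)

/-- The quotient rule exhibits the derivative as a rational function of the point whose denominator
has no zero on `S`, hence as a regular scalar family. -/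
theorem der_eq {S : Set ℂ} {f : RatFunc ℂ} (hf : VanishReg S f) {z : ℂ} (hz : z ∈ S) :
    der z f = (derivative f.num * f.denom - f.num * derivative f.denom).eval z /
      (f.denom ^ 2).eval z := by
  have h := (f.num.hasDerivAt z).div (f.denom.hasDerivAt z) (hf.2 z hz)
  rw [eval_sub, eval_mul, eval_mul, eval_pow]
  exact h.deriv

/-- The vector `ι̂^v(t) y` varies regularly with `t`. -/
theorem iota_mem_regularFamilies (v : 𝔤) (y : Env 𝔤 V) :
    (fun t : V => restr (Set.empty_subset V) (iota B t.2 hB v y)) ∈ regularFamilies 𝔤 V := by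
  induction y using env_induction generalizing v with
  | h1 =>
    simp only [iota_one, map_zero]
    exact zero_mem _
  | hadd x y hx hy =>
    simp only [map_add]
    exact add_mem (hx v) (hy v)
  | hsmul c x hx =>
    simp only [map_smul]
    exact Subalgebra.smul_mem _ (hx v) c
  | hmul α x hx =>
    simp only [iota_gen_mul, map_add, map_sub, map_mul, map_smul]
    refine add_mem (sub_mem (sub_mem (mul_mem (const_mem_regularFamilies _) (hx v)) ?_) ?_) ?_
    · refine mul_mem ?_ (const_mem_regularFamilies _)
      induction α using gMinus_induction with
      | h0 =>
        simp only [map_zero]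
        exact zero_mem _
      | h1 w f =>
        simp only [divBracket_pure, restr_gen, incl_pure]
        exact gen_tens_mem_regularFamilies _ (isFunctionFamily_divDiff f)
      | h2 α β hα hβ =>
        simp only [map_add]
        exact add_mem hα hβ
    · induction α using gMinus_induction with
      | h0 =>
        simp only [map_zero, zero_smul]
        exact zero_mem _
      | h1 w f =>
        have hk : ∀ t ∈ V, ((f : RatFunc ℂ).denom ^ 2).eval t ≠ 0 := fun t ht => by
          rw [eval_pow]
          exact pow_ne_zero _ (f.2.2 t ht)
        have h := smul_mem_regularFamilies hk (p := derivative (f : RatFunc ℂ).num *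
          (f : RatFunc ℂ).denom - (f : RatFunc ℂ).num * derivative (f : RatFunc ℂ).denom)
          (const_mem_regularFamilies (B v w • restr (Set.empty_subset V) x))
        refine (congrArg (· ∈ regularFamilies 𝔤 V) (funext fun t => ?_)).mp h
        rw [derivAt_pure, der_eq f.2 t.2, map_smul, smul_smul, smul_eq_mul]
      | h2 α β hα hβ =>
        simp only [map_add, add_smul]
        exact add_mem hα hβ
    · induction α using gMinus_induction with
      | h0 =>
        simp only [map_zero, lie_zero, LinearMap.zero_apply]
        exact zero_mem _
      | h1 w f =>
        -- The index `[v, α(t)]` moves with `t`, but for `α = w ⊗ f` it is `f(t) [v, w]`; the scalar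
        -- comes out and the induction hypothesis applies to the fixed vector `[v, w]`.
        have h := smul_mem_regularFamilies (p := (f : RatFunc ℂ).num) f.2.2 (hx ⁅v, w⁆)
        refine (congrArg (· ∈ regularFamilies 𝔤 V) (funext fun t => ?_)).mp h
        rw [valueAt_pure, lie_smul, map_smul, LinearMap.smul_apply, map_smul]
        rfl
      | h2 α β hα hβ =>
        simp only [map_add, lie_add, LinearMap.add_apply]
        exact add_mem hα hβ

/-- The derivative is the value at `z` of the regular slope family of `t ↦ ι̂^v(t) y`. -/
theorem exists_hasIotaDeriv {z : ℂ} (hz : z ∈ V) (v : 𝔤) (y : Env 𝔤 V) :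
    ∃ D, HasIotaDeriv B hB hz v y D := by
  obtain ⟨G, hG, e⟩ :=
    exists_slope_of_mem_regularFamilies (iota_mem_regularFamilies B hB v y) ⟨z, hz⟩
  exact ⟨G ⟨z, hz⟩, G, hG,
    fun t => (eq_inv_smul_iff₀ (sub_ne_zero.2 fun h => t.2.2 h)).2 (e ⟨t, t.2.1⟩), rfl⟩

/-- Every vector regular at `z` is regular on a Zariski neighbourhood of `z`. -/
theorem exists_restr_eq {z : ℂ} (x : Env 𝔤 {z}) :
    ∃ (V : Set ℂ) (hz : z ∈ V) (y : Env 𝔤 V), Vᶜ.Finite ∧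
      restr (Set.singleton_subset_iff.2 hz) y = x := by
  have hbase : ∀ {V W : Set ℂ}, Vᶜ.Finite → Wᶜ.Finite → (V ∩ W)ᶜ.Finite := fun hV hW => by
    rw [Set.compl_inter]
    exact hV.union hW
  have hgen : ∀ α : gMinus 𝔤 {z}, ∃ (V : Set ℂ) (hz : z ∈ V) (β : gMinus 𝔤 V), Vᶜ.Finite ∧
      incl (Set.singleton_subset_iff.2 hz) β = α := by
    intro α
    induction α using gMinus_induction with
    | h0 => exact ⟨Set.univ, trivial, 0, by simp, by simp⟩
    | h1 x f =>
      -- The neighbourhood is the complement of the poles of `f`; sums and products later live on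
      -- intersections.
      refine ⟨{w | (f : RatFunc ℂ).denom.eval w ≠ 0}, f.2.2 z rfl, tens x ⟨f, f.2.1, fun _ h => h⟩,
        ?_, rfl⟩
      refine ((f : RatFunc ℂ).denom.rootSet_finite ℂ).subset fun w hw => ?_
      rw [mem_rootSet]
      exact ⟨RatFunc.denom_ne_zero _, by simpa using hw⟩
    | h2 α β hα hβ =>
      obtain ⟨V, hz, α', hV, rfl⟩ := hα
      obtain ⟨W, hz', β', hW, rfl⟩ := hβ
      exact ⟨V ∩ W, ⟨hz, hz'⟩, incl Set.inter_subset_left α' + incl Set.inter_subset_right β',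
        hbase hV hW, by simp only [map_add, incl_incl]⟩
  induction x using env_induction with
  | h1 => exact ⟨Set.univ, trivial, 1, by simp, by simp⟩
  | hadd x y hx hy =>
    obtain ⟨V, hz, x', hV, rfl⟩ := hx
    obtain ⟨W, hz', y', hW, rfl⟩ := hy
    exact ⟨V ∩ W, ⟨hz, hz'⟩, restr Set.inter_subset_left x' + restr Set.inter_subset_right y',
      hbase hV hW, by simp only [map_add, restr_restr]⟩
  | hsmul c x hx =>
    obtain ⟨V, hz, x', hV, rfl⟩ := hx
    exact ⟨V, hz, c • x', hV, map_smul _ _ _⟩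
  | hmul α x hx =>
    obtain ⟨V, hz, α', hV, rfl⟩ := hgen α
    obtain ⟨W, hz', x', hW, rfl⟩ := hx
    exact ⟨V ∩ W, ⟨hz, hz'⟩,
      gen (incl Set.inter_subset_left α') * restr Set.inter_subset_right x',
      hbase hV hW, by simp only [map_mul, restr_gen, incl_incl, restr_restr]⟩

/-! ### The operator product expansion -/

/-- The divided difference of `1 / (u - z)` at `w` is `-1 / ((w - z)(u - z))`: the pole stays at
`z`, and the factor `(w - z)⁻¹` becomes the simple pole of the operator product. -/
theorem divBracket_polePart {S : Set ℂ} {z w : ℂ} (hw : w ∈ S) (hz : z ∉ S) (v₂ v₁ : 𝔤) :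
    divBracket hw v₂ (polePart S hz v₁) = -((w - z)⁻¹ • polePart S hz ⁅v₂, v₁⁆) := by
  have hne : w ≠ z := ne_of_mem_of_not_mem hw hz
  change tens ⁅v₂, v₁⁆ _ = -(_ • tens ⁅v₂, v₁⁆ _)
  rw [← pure_smul, ← neg_one_smul ℂ (tens _ _), ← pure_smul]
  congr 1
  apply Subtype.ext
  change ((RatFunc.X - RatFunc.C z)⁻¹ - RatFunc.C (val w (RatFunc.X - RatFunc.C z)⁻¹)) /
    (RatFunc.X - RatFunc.C w) = (-1 : ℂ) • (w - z)⁻¹ • (RatFunc.X - RatFunc.C z)⁻¹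
  have e₁ := X_sub_C_ne_zero' z
  have e₂ := X_sub_C_ne_zero' w
  have e₃ : (RatFunc.C w - RatFunc.C z : RatFunc ℂ) ≠ 0 :=
    sub_ne_zero.2 (RatFunc.C_injective.ne hne)
  rw [val_pole hne, neg_one_smul, RatFunc.smul_eq_C_mul, map_inv₀, map_sub]
  field_simp
  ring

/-- The operator product of two currents, before passing to the limit. -/
theorem current_current_sub (hsymm : B.IsSymm) {z t : ℂ} (hz : z ∈ V) (ht : t ∈ V \ {z})
    (v₁ v₂ : 𝔤) (y : Env 𝔤 V) :
    current B ht hB (Set.empty_subset _) (Set.notMem_empty _) v₂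
        (current B (T := V \ {z}) hz hB Set.sdiff_subset (fun h => h.2 rfl) v₁ y)
      - (B v₁ v₂ / (z - t) ^ 2) • restr (Set.empty_subset V) y
      - (1 / (t - z)) • current B hz hB (Set.empty_subset _) (Set.notMem_empty _) ⁅v₂, v₁⁆ y =
    restr (Set.empty_subset V) (iota B ht.1 hB v₂ (iota B hz hB v₁ y))
      + gen (polePart ∅ (Set.notMem_empty t) v₂) *
        (gen (polePart ∅ (Set.notMem_empty z) v₁) * restr (Set.empty_subset V) y)
      + gen (polePart ∅ (Set.notMem_empty t) v₂) *
        restr (Set.empty_subset V) (iota B hz hB v₁ y)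
      + gen (polePart ∅ (Set.notMem_empty z) v₁) *
        restr (Set.empty_subset V) (iota B ht.1 hB v₂ y)
      + (t - z)⁻¹ • (restr (Set.empty_subset V) (iota B ht.1 hB ⁅v₂, v₁⁆ y) -
        restr (Set.empty_subset V) (iota B hz hB ⁅v₂, v₁⁆ y)) := by
  have hsub : V \ {z} ⊆ V := Set.sdiff_subset
  have hz' : z ∉ V \ {z} := fun h => h.2 rfl
  have e₁ : B v₂ v₁ = B v₁ v₂ := hsymm.eq v₂ v₁
  have e₃ : (z - t) ^ 2 = (t - z) ^ 2 := by ring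
  -- Passing `v₁ / (u - z)`, the field `ι̂^{v₂}(t)` yields `(v₁, v₂) / (t - z)²` and `(t - z)⁻¹`
  -- times `ε̂^{[v₂,v₁]}(z) + ι̂^{[v₂,v₁]}(t)`; the subtracted terms cancel all but the difference
  -- quotient.
  simp only [current_apply, map_add, map_mul, map_sub, map_smul, map_neg, restr_gen, restr_restr,
    iota_gen_mul, valueAt_polePart ht hz', derivAt_polePart ht hz', divBracket_polePart ht hz',
    ← restr_iota B hB hsub ht.1 ht, lie_smul, LinearMap.smul_apply,
    incl_polePart _ hz' (Set.notMem_empty z), e₁, e₃, smul_add, smul_sub, one_mul,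
    smul_eq_mul, neg_mul, smul_mul_assoc, neg_smul, div_eq_mul_inv, mul_comm (B v₁ v₂)]
  abel

/-- On the right of `current_current_sub` only the difference quotient is singular at `t = z`, and
`hD` supplies its extension; each remaining term is already a regular family over `V`. -/
theorem hasLimit_current_current (hsymm : B.IsSymm) {z : ℂ} (hz : z ∈ V) (v₁ v₂ : 𝔤)
    (y : Env 𝔤 V) {D : Env 𝔤 ∅} (hD : HasIotaDeriv B hB hz ⁅v₂, v₁⁆ y D) :
    HasLimit hz
      (fun t => current B (S := V \ {z}) (T := ∅) (z := t) t.2 hB (Set.empty_subset _)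
            (Set.notMem_empty _) v₂
          (current B (S := V) (T := V \ {z}) hz hB Set.sdiff_subset (fun h => h.2 rfl) v₁ y)
        - (B v₁ v₂ / (z - t) ^ 2) • restr (Set.empty_subset V) y
        - (1 / ((t : ℂ) - z)) • current B (S := V) (T := ∅) hz hB
            (Set.empty_subset _) (Set.notMem_empty _) ⁅v₂, v₁⁆ y)
      (restr (Set.empty_subset V) (iota B hz hB v₂ (iota B hz hB v₁ y))
        + gen (polePart ∅ (Set.notMem_empty z) v₂) *
          (gen (polePart ∅ (Set.notMem_empty z) v₁) * restr (Set.empty_subset V) y)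
        + gen (polePart ∅ (Set.notMem_empty z) v₂) *
          restr (Set.empty_subset V) (iota B hz hB v₁ y)
        + gen (polePart ∅ (Set.notMem_empty z) v₁) *
          restr (Set.empty_subset V) (iota B hz hB v₂ y) + D) := by
  obtain ⟨F, hF, hFt, rfl⟩ := hD
  have hpole : (fun t : V => gen (polePart ∅ (Set.notMem_empty (t : ℂ)) v₂)) ∈
      regularFamilies 𝔤 V :=
    gen_tens_mem_regularFamilies v₂ isFunctionFamily_pole
  refine ⟨fun t => restr (Set.empty_subset V) (iota B t.2 hB v₂ (iota B hz hB v₁ y))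
      + gen (polePart ∅ (Set.notMem_empty (t : ℂ)) v₂) *
        (gen (polePart ∅ (Set.notMem_empty z) v₁) * restr (Set.empty_subset V) y)
      + gen (polePart ∅ (Set.notMem_empty (t : ℂ)) v₂) *
        restr (Set.empty_subset V) (iota B hz hB v₁ y)
      + gen (polePart ∅ (Set.notMem_empty z) v₁) *
        restr (Set.empty_subset V) (iota B t.2 hB v₂ y) + F t, ?_, fun t => ?_, rfl⟩
  · exact add_mem (add_mem (add_mem (add_mem (iota_mem_regularFamilies B hB v₂ (iota B hz hB v₁ y))
      (mul_mem hpole (const_mem_regularFamilies _))) (mul_mem hpole (const_mem_regularFamilies _)))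
      (mul_mem (const_mem_regularFamilies _) (iota_mem_regularFamilies B hB v₂ y))) hF
  · beta_reduce
    rw [current_current_sub B hB hsymm hz t.2 v₁ v₂ y, hFt t]

end Families

end Currents

end CurrentAlgebra
end

theorem mainTheorem1 {𝔤 : Type*} [LieRing 𝔤] [LieAlgebra ℂ 𝔤] (B : LinearMap.BilinForm ℂ 𝔤)
    (hsymm : B.IsSymm) (hnondeg : B.Nondegenerate) (hB : B.lieInvariant 𝔤) :
    -- the currents at distinct points can be composed and commute
    (∀ (z₁ z₂ : ℂ) (hne : z₁ ≠ z₂) (v₁ v₂ : 𝔤),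
      (current B (S := {z₁}) (T := ∅) (Set.mem_singleton z₁) hB
          (Set.empty_subset _) (Set.notMem_empty _) v₁) ∘ₗ
        (current B (S := {z₁, z₂}) (T := {z₁}) (z := z₂) (by simp) hB
          (by simp) (by simpa using hne.symm) v₂)
      = (current B (S := {z₂}) (T := ∅) (Set.mem_singleton z₂) hB
          (Set.empty_subset _) (Set.notMem_empty _) v₂) ∘ₗ
        (current B (S := {z₁, z₂}) (T := {z₂}) (z := z₁) (by simp) hB
          (by simp) (by simpa using hne) v₁)) ∧
    -- the operator product expansion, applied to a vector `x`
    (∀ (z₁ : ℂ) (v₁ v₂ : 𝔤) (x : Env 𝔤 {z₁}),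
      -- `x` has an adapted Zariski neighbourhood
      (∃ (V : Set ℂ) (hz : z₁ ∈ V) (y : Env 𝔤 V), Vᶜ.Finite ∧
        restr (Set.singleton_subset_iff.2 hz) y = x) ∧
      -- and on any such neighbourhood `V` the limit is as stated
      ∀ (V : Set ℂ) (hz : z₁ ∈ V) (y : Env 𝔤 V), Vᶜ.Finite →
        restr (Set.singleton_subset_iff.2 hz) y = x →
        ∃ D : Env 𝔤 ∅, HasIotaDeriv B hB hz ⁅v₂, v₁⁆ y D ∧
          HasLimit hz
            (fun z₂ =>
              current B (S := V \ {z₁}) (T := ∅) (z := z₂) z₂.2 hB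
                  (Set.empty_subset _) (Set.notMem_empty _) v₂
                (current B (S := V) (T := V \ {z₁}) hz hB
                  Set.sdiff_subset (fun h => h.2 rfl) v₁ y)
              - (B v₁ v₂ / (z₁ - z₂) ^ 2) • restr (Set.empty_subset V) y
              - (1 / ((z₂ : ℂ) - z₁)) • current B (S := V) (T := ∅) hz hB
                  (Set.empty_subset _) (Set.notMem_empty _) ⁅v₂, v₁⁆ y)
            (restr (Set.empty_subset _) (iota B (Set.mem_singleton z₁) hB v₂
                (iota B (Set.mem_singleton z₁) hB v₁ x))
              + epsilon ∅ (Set.notMem_empty z₁) v₂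
                  (epsilon ∅ (Set.notMem_empty z₁) v₁ (restr (Set.empty_subset _) x))
              + epsilon ∅ (Set.notMem_empty z₁) v₂
                  (restr (Set.empty_subset _) (iota B (Set.mem_singleton z₁) hB v₁ x))
              + epsilon ∅ (Set.notMem_empty z₁) v₁
                  (restr (Set.empty_subset _) (iota B (Set.mem_singleton z₁) hB v₂ x))
              + D)) := by
  refine ⟨fun z₁ z₂ hne v₁ v₂ => LinearMap.ext fun x => ?_,
    fun z₁ v₁ v₂ x => ⟨exists_restr_eq x, ?_⟩⟩
  · exact current_comm B hB hsymm hne (S := {z₁, z₂}) (T₁ := {z₁}) (T₂ := {z₂}) (T := ∅)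
      (by simp) (by simp) (by simp) (by simp) rfl (by simpa using hne.symm) rfl
      (by simpa using hne) (Set.empty_subset _) (Set.empty_subset _) v₁ v₂ x
  · rintro V hz y - rfl
    obtain ⟨D, hD⟩ := exists_hasIotaDeriv B hB hz ⁅v₂, v₁⁆ y
    refine ⟨D, hD, ?_⟩
    have h := hasLimit_current_current B hB hsymm hz v₁ v₂ y hD
    have hV : {z₁} ⊆ V := Set.singleton_subset_iff.2 hz
    -- The stated value uses `ι̂` on `{z₁}`; since `ι̂` commutes with restriction it can be computed
    -- on `V`.
    simp only [← restr_iota B hB hV hz, restr_restr]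
    exact h
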